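/- Let $(X,\mathcal B,\mu)$ be a $\sigma$-finite measure space and let $T:X\to X$ be a measure-preserving transformation which is conservative, i.e. for every $A\in\mathcal B$ with $\mu(A)>0$ there is $n\ge 1$ with $\mu(A\cap T^{-n}A)>0$. Let $(a_n)_{n\ge 1}$ be a sequence of measurable functions $X\to[-\infty,+\infty]$ which is subadditive, i.e. for all $n,m\ge 1$, $a_{n+m}\le a_n+a_m\circ T^n$ $\mu$-almost everywhere, and suppose that $(a_1)^+=\max(a_1,0)$ is $\mu$-integrable. Let $g\in L^1(X,\mu)$ be real-valued with $g>0$ $\mu$-almost everywhere, and write $S_n g=\sum_{k=0}^{n-1} g\circ T^k$. Then the limit $$h:=\lim_{n\to+\infty}\frac{a_n}{S_n g}\in[-\infty,+\infty)$$ exists $\mu$-almost everywhere. Moreover the positive parts of $a_n$ ($n\ge1$) and of $hg$ are $\mu$-integrable, so that their integrals over measurable sets are well defined in $[-\infty,+\infty)$, and for every $A\in\mathcal B$ with $T^{-1}A=A$, $$\inf_{n\ge1}\frac1n\int_A a_n\,d\mu=\lim_{n\to+\infty}\frac1n\int_A a_n\,d\mu=\int_A hg\,d\mu\in[-\infty,+\infty).$$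 -/

import Mathlib

open MeasureTheory Filter Topology

/-- The positive part of an extended-real-valued function has finite integral. -/
def PosPartIntegrable {X : Type*} [MeasurableSpace X] (μ : Measure X) (f : X → EReal) : Prop :=
  ∫⁻ x, (f x).toENNReal ∂μ < ⊤

/-- The integral `∫ f⁺ - ∫ f⁻` of an extended-real-valued measurable function, with values in
`[-∞, ∞]`. It is meaningful when at least one of the two integrals is finite, in particular
when `PosPartIntegrable μ f` holds. -/
noncomputable def extIntegral {X : Type*} [MeasurableSpace X] (μ : Measure X)
    (f : X → EReal) : EReal :=
  ((∫⁻ x, (f x).toENNReal ∂μ : ENNReal) : EReal) - ((∫⁻ x, (-f x).toENNReal ∂μ : ENNReal) : EReal)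

/-- A sequence `(a n)`, `n ≥ 1`, of functions is subadditive with respect to `T` if for all
`n, m ≥ 1`, almost everywhere `a (n + m) ≤ a n + a m ∘ T^n`. The value of `a 0` is irrelevant. -/
def SubadditiveSeq {X : Type*} [MeasurableSpace X] (μ : Measure X) (T : X → X)
    (a : ℕ → X → EReal) : Prop :=
  ∀ n m : ℕ, 1 ≤ n → 1 ≤ m → ∀ᵐ x ∂μ, a (n + m) x ≤ a n x + a m (T^[n] x)

/-! ### Chacon–Ornstein lemma and maximal inequality for nonnegative functions. -/

section General

variable {X : Type*} [MeasurableSpace X] {μ : Measure X} {T : X → X}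

/-! The function `h` is the lower limit of `a n / S_n g`. Conservativity forces `S_n g → ∞`, so `a
(n+1) ≤ a 1 + a n ∘ T` gives `h ≤ h ∘ T`, and recurrence turns this into `h ∘ T = h`. Functions of
`h` therefore factor out of Birkhoff sums.

The engine is a comparison principle. Suppose `ψ` is integrable and almost every `x` has some `n ≥
1` with `a n x ≤ S_n ψ x`. Then `∫ (a n - S_n ψ)⁺ = o(n)`, and for every measurable `g > 0`,
eventually `a n ≤ S_n ψ + S_n g`. After subtracting `S_n ψ`, one jumps along the orbit by times at
which the cocycle is nonpositive (`subadditive_orbit_bound`): only visits to a set on which `(a 1)⁺`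
has small integral, and the last `N` steps, cost anything. Integrating gives the first claim; the
maximal inequality and the Chacon–Ornstein lemma give the second.

With `ψ = (max h (-M) + ε) g` the principle bounds the upper limits of both `a n / S_n g` and `(1/n)
∫ a n`. Applied to additive sequences it says that `∫ ψ ≤ 0` when some `S_n ψ x ≤ 0` for almost
every `x`; this yields integrability of `(h g)⁺` and, for the map `T^[k]`, the lower bound `∫ h g ≤
(1/k) ∫ a k`. Invariant sets are handled by restricting the measure. -/

theorem ae_forall_iterate (hT : Measure.QuasiMeasurePreserving T μ μ) {p : X → Prop}
    (h : ∀ᵐ x ∂μ, p x) : ∀ᵐ x ∂μ, ∀ k : ℕ, p (T^[k] x) :=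
  ae_all_iff.2 fun k => (hT.iterate k).ae h

theorem measurable_birkhoffSum {M : Type*} [AddCommMonoid M] [MeasurableSpace M]
    [MeasurableAdd₂ M] (hT : Measurable T) {f : X → M} (hf : Measurable f) (n : ℕ) :
    Measurable (birkhoffSum T f n) := by
  unfold birkhoffSum
  exact Finset.measurable_sum _ fun k _ => hf.comp (hT.iterate k)

theorem lintegral_birkhoffSum (hT : MeasurePreserving T μ μ) {f : X → ENNReal}
    (hf : Measurable f) (n : ℕ) : ∫⁻ x, birkhoffSum T f n x ∂μ = n * ∫⁻ x, f x ∂μ := by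
  unfold birkhoffSum
  rw [lintegral_finsetSum (f := fun k x => f (T^[k] x)) _
    fun k _ => hf.comp (hT.measurable.iterate k)]
  simp [fun k => (hT.iterate k).lintegral_comp hf]

/-- The Chacon–Ornstein lemma for measure-preserving maps. -/
theorem ae_eventually_iterate_le_birkhoffSum (hT : MeasurePreserving T μ μ)
    {f g : X → ENNReal} (hf : Measurable f) (hg : Measurable g)
    (hfi : ∫⁻ x, f x ∂μ ≠ ⊤) (hg0 : ∀ᵐ x ∂μ, g x ≠ 0) :
    ∀ᵐ x ∂μ, ∀ᶠ n in atTop, f (T^[n] x) ≤ birkhoffSum T g n x := by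
  set v : ℕ → X → ENNReal := fun n x => f (T^[n] x) - birkhoffSum T g n x with hv
  have hvm : ∀ n, Measurable (v n) := fun n =>
    (hf.comp (hT.measurable.iterate n)).sub (measurable_birkhoffSum hT.measurable hg n)
  -- Truncated subtraction gives `v (n+1) = (v n ∘ T - g)⁺`, so a loss of `g` occurs wherever `v
  -- (n+1) ≠ 0`. The total loss is at most `∫ f`, and a Borel–Cantelli argument concludes.
  have hstep : ∀ n x, v (n + 1) x + {y | v (n + 1) y ≠ 0}.indicator g x ≤ v n (T x) := by
    intro n x
    have e : v (n + 1) x = v n (T x) - g x := by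
      simp only [hv, birkhoffSum_succ', Function.iterate_succ_apply]
      rw [add_comm, tsub_add_eq_tsub_tsub]
    by_cases h0 : v (n + 1) x = 0
    · simp [h0]
    · rw [Set.indicator_of_mem (by exact h0)]
      rw [e] at h0 ⊢
      exact (tsub_add_cancel_of_le (tsub_pos_iff_lt.1 (pos_iff_ne_zero.2 h0)).le).le
  have hms : ∀ n, MeasurableSet {y | v n y ≠ 0} := fun n =>
    (hvm n (measurableSet_singleton 0)).compl
  have hint : ∀ n, ∫⁻ x, v (n + 1) x ∂μ + ∫⁻ x, {y | v (n + 1) y ≠ 0}.indicator g x ∂μ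
      ≤ ∫⁻ x, v n x ∂μ := by
    intro n
    rw [← lintegral_add_left (hvm _), ← hT.lintegral_comp (hvm n)]
    exact lintegral_mono (hstep n)
  have hsum : ∀ n, ∫⁻ x, v n x ∂μ + ∑ k ∈ Finset.range n,
      ∫⁻ x, {y | v (k + 1) y ≠ 0}.indicator g x ∂μ ≤ ∫⁻ x, f x ∂μ := by
    intro n
    induction n with
    | zero => simp [hv]
    | succ n ih =>
      rw [Finset.sum_range_succ, add_comm (Finset.sum _ _), ← add_assoc]
      exact (add_le_add_left (hint n) _).trans ih
  have htsum : ∫⁻ x, ∑' k, {y | v (k + 1) y ≠ 0}.indicator g x ∂μ ≤ ∫⁻ x, f x ∂μ := by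
    rw [lintegral_tsum fun k => (hg.indicator (hms _)).aemeasurable]
    exact ENNReal.tsum_le_of_sum_range_le fun n => le_add_self.trans (hsum n)
  have hfin := ae_lt_top (Measurable.tsum fun k => hg.indicator (hms (k + 1)))
    (ne_top_of_le_ne_top hfi htsum)
  filter_upwards [hfin, hg0] with x hx hgx
  have hlim := ENNReal.tendsto_atTop_zero_of_tsum_ne_top hx.ne
  have hev : ∀ᶠ k in atTop, {y | v (k + 1) y ≠ 0}.indicator g x < g x :=
    hlim.eventually_lt_const (pos_iff_ne_zero.2 hgx)
  obtain ⟨K, hK⟩ := eventually_atTop.1 hev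
  refine eventually_atTop.2 ⟨K + 1, fun n hn => ?_⟩
  obtain ⟨k, rfl⟩ : ∃ k, n = k + 1 := ⟨n - 1, by omega⟩
  have h1 := hK k (by omega)
  by_contra hlt
  have : v (k + 1) x ≠ 0 := by
    simp only [hv, ne_eq, tsub_eq_zero_iff_le]; exact hlt
  rw [Set.indicator_of_mem (by exact this)] at h1
  exact lt_irrefl _ h1

/-- The maximal ergodic inequality for ratios of sums of nonnegative functions. -/
theorem setLIntegral_maximal_le (hT : MeasurePreserving T μ μ)
    {f g : X → ENNReal} (hf : Measurable f) (hg : Measurable g) (hfi : ∫⁻ x, f x ∂μ ≠ ⊤) :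
    ∫⁻ x in {x | ∃ n, birkhoffSum T g n x < birkhoffSum T f n x}, g x ∂μ ≤ ∫⁻ x, f x ∂μ := by
  -- The recursion `w (n+1) = (w n ∘ T + f - g)⁺` makes `w n` increasing in `n` and at least `S_n f
  -- - S_n g`.
  let w : ℕ → X → ENNReal := fun n => Nat.rec (fun _ => 0) (fun _ u x => u (T x) + f x - g x) n
  have w0 : ∀ x, w 0 x = 0 := fun _ => rfl
  have ws : ∀ n x, w (n + 1) x = w n (T x) + f x - g x := fun _ _ => rfl
  have hwm : ∀ n, Measurable (w n) := by
    intro n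
    induction n with
    | zero => exact measurable_const
    | succ n ih => exact ((ih.comp hT.measurable).add hf).sub hg
  have hmono1 : ∀ n x, w n x ≤ w (n + 1) x := by
    intro n
    induction n with
    | zero => intro x; rw [w0]; exact zero_le
    | succ n ih =>
      intro x
      rw [ws, ws (n + 1)]
      exact tsub_le_tsub_right (add_le_add_left (ih _) _) _
  have hmono : ∀ x, Monotone fun n => w n x := fun x => monotone_nat_of_le_succ (hmono1 · x)
  have hfin : ∀ n, ∫⁻ x, w n x ∂μ ≠ ⊤ := by
    intro n
    induction n with
    | zero => simp [w0]
    | succ n ih =>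
      refine ne_top_of_le_ne_top (ENNReal.add_ne_top.2 ⟨ih, hfi⟩) ?_
      rw [← hT.lintegral_comp (hwm n), ← lintegral_add_right _ hf]
      exact lintegral_mono fun x => (ws n x).le.trans tsub_le_self
  have hms : ∀ n, MeasurableSet {y | w n y ≠ 0} := fun n =>
    (hwm n (measurableSet_singleton 0)).compl
  have hset : ∀ n, ∫⁻ x in {y | w n y ≠ 0}, g x ∂μ ≤ ∫⁻ x, f x ∂μ := by
    intro n
    rcases n with _ | n
    · simp [w0]
    rw [← lintegral_indicator (hms (n + 1))]
    have h1 : ∫⁻ x, w (n + 1) x ∂μ + ∫⁻ x, {y | w (n + 1) y ≠ 0}.indicator g x ∂μ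
        ≤ ∫⁻ x, w n x ∂μ + ∫⁻ x, f x ∂μ := by
      rw [← lintegral_add_left (hwm (n + 1)), ← hT.lintegral_comp (hwm n),
        ← lintegral_add_right _ hf]
      refine lintegral_mono fun x => ?_
      by_cases h0 : w (n + 1) x = 0
      · simp [h0]
      · rw [Set.indicator_of_mem (by exact h0)]
        rw [ws] at h0 ⊢
        exact (tsub_add_cancel_of_le (tsub_pos_iff_lt.1 (pos_iff_ne_zero.2 h0)).le).le
    have h2 : ∫⁻ x, w n x ∂μ ≤ ∫⁻ x, w (n + 1) x ∂μ := lintegral_mono (hmono1 n)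
    exact (ENNReal.add_le_add_iff_left (hfin (n + 1))).1 (h1.trans (add_le_add_left h2 _))
  have hle : ∀ n x, birkhoffSum T f n x ≤ birkhoffSum T g n x + w n x := by
    intro n
    induction n with
    | zero => simp
    | succ n ih =>
      intro x
      rw [birkhoffSum_succ', birkhoffSum_succ']
      calc f x + birkhoffSum T f n (T x) ≤ f x + (birkhoffSum T g n (T x) + w n (T x)) :=
            add_le_add_right (ih _) _
        _ = (w n (T x) + f x) + birkhoffSum T g n (T x) := by ring
        _ ≤ (g x + w (n + 1) x) + birkhoffSum T g n (T x) := by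
            rw [ws]; exact add_le_add_left le_add_tsub _
        _ = _ := by ring
  have hsub : {x | ∃ n, birkhoffSum T g n x < birkhoffSum T f n x} ⊆ ⋃ n, {y | w n y ≠ 0} := by
    rintro x ⟨n, hn⟩
    refine Set.mem_iUnion.2 ⟨n, fun h0 => ?_⟩
    have := hle n x
    rw [h0, add_zero] at this
    exact absurd hn (not_lt.2 this)
  refine (lintegral_mono_set hsub).trans ?_
  have hdir : Monotone fun n => {y | w n y ≠ 0} := by
    intro m n hmn y hy h0
    exact hy (le_antisymm (h0 ▸ hmono y hmn) zero_le)
  rw [setLIntegral_iUnion_of_directed _ hdir.directed_le]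
  exact iSup_le hset

end General

/-! ### Subadditive sequences that are nonpositive at some time. -/

section Core

theorem le_coe_toENNReal (x : EReal) : x ≤ (x.toENNReal : EReal) := by
  rw [EReal.coe_toENNReal_eq_max]
  exact le_max_right _ _

variable {X : Type*} {T : X → X}

theorem le_birkhoffSum_toENNReal {a : ℕ → X → EReal} {s : Set X} (hs : ∀ x ∈ s, T x ∈ s)
    (hsub : ∀ x ∈ s, ∀ n m : ℕ, 1 ≤ n → 1 ≤ m → a (n + m) x ≤ a n x + a m (T^[n] x))
    {n : ℕ} (hn : 1 ≤ n) {x : X} (hx : x ∈ s) :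
    a n x ≤ (birkhoffSum T (fun y => (a 1 y).toENNReal) n x : ENNReal) := by
  induction n, hn using Nat.le_induction generalizing x with
  | base => simpa using le_coe_toENNReal (a 1 x)
  | succ n hn ih =>
    rw [add_comm n 1]
    refine (hsub x hx 1 n le_rfl hn).trans ?_
    rw [add_comm 1 n, birkhoffSum_succ', EReal.coe_ennreal_add]
    exact add_le_add (le_coe_toENNReal _) (ih (hs x hx))

/-- If along the orbit of `x` some `a m`, `m ≤ N`, is nonpositive outside the set of `y` with
`a 1 y, …, a N y > 0`, only the visits to that set and the last `N` steps contribute to `a n x`. -/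
theorem subadditive_orbit_bound {a : ℕ → X → EReal} {s : Set X} (hs : ∀ x ∈ s, T x ∈ s)
    (hsub : ∀ x ∈ s, ∀ n m : ℕ, 1 ≤ n → 1 ≤ m → a (n + m) x ≤ a n x + a m (T^[n] x))
    (N : ℕ) {n : ℕ} (hn : 1 ≤ n) {x : X} (hx : x ∈ s) :
    a n x ≤ ((birkhoffSum T
        ({y | ∀ m, 1 ≤ m → m ≤ N → 0 < a m y}.indicator fun y => (a 1 y).toENNReal) n x
      + ∑ k ∈ Finset.Ico (n - N) n, (a 1 (T^[k] x)).toENNReal : ENNReal) : EReal) := by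
  set B : Set X := {y | ∀ m, 1 ≤ m → m ≤ N → 0 < a m y} with hB
  set d : X → ENNReal := fun y => (a 1 y).toENNReal with hd
  have hsk : ∀ k, ∀ x ∈ s, T^[k] x ∈ s := by
    intro k
    induction k with
    | zero => exact fun x hx => hx
    | succ k ih => exact fun x hx => by rw [Function.iterate_succ_apply]; exact ih _ (hs x hx)
  induction n using Nat.strong_induction_on generalizing x with
  | _ n ih =>
  rcases le_or_gt n N with hnN | hnN
  · refine (le_birkhoffSum_toENNReal hs hsub hn hx).trans ?_
    rw [Nat.sub_eq_zero_of_le hnN, ← Finset.range_eq_Ico]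
    exact EReal.coe_ennreal_le_coe_ennreal_iff.2 le_add_self
  -- a shift by `m` steps of the bound for `n - m`
  have key : ∀ m, 1 ≤ m → m < n →
      a (n - m) (T^[m] x) ≤ ((∑ k ∈ Finset.Ico m n, B.indicator d (T^[k] x)
        + ∑ k ∈ Finset.Ico (n - N) n, d (T^[k] x) : ENNReal) : EReal) := by
    intro m hm hmn
    refine (ih (n - m) (by omega) (by omega) (hsk m x hx)).trans ?_
    refine EReal.coe_ennreal_le_coe_ennreal_iff.2 (add_le_add (le_of_eq ?_) ?_)
    · rw [birkhoffSum, Finset.sum_Ico_eq_sum_range]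
      refine Finset.sum_congr rfl fun k _ => ?_
      rw [← Function.iterate_add_apply, add_comm k m]
    · have e : ∑ k ∈ Finset.Ico (n - m - N) (n - m), (a 1 (T^[k] (T^[m] x))).toENNReal
          = ∑ k ∈ Finset.Ico (n - m - N + m) (n - m + m), d (T^[k] x) := by
        rw [← Finset.sum_Ico_add']
        refine Finset.sum_congr rfl fun k _ => ?_
        rw [← Function.iterate_add_apply]
      rw [e]
      refine Finset.sum_le_sum_of_subset fun k hk => ?_
      simp only [Finset.mem_Ico] at hk ⊢
      omega
  have hsplit : ∀ m, m ≤ n → birkhoffSum T (B.indicator d) n x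
      = ∑ k ∈ Finset.range m, B.indicator d (T^[k] x)
        + ∑ k ∈ Finset.Ico m n, B.indicator d (T^[k] x) := fun m hm =>
    (Finset.sum_range_add_sum_Ico _ hm).symm
  -- In `B`, advance one step and charge it to the indicator sum; outside `B`, jump by an `m ≤ N`
  -- with `a m x ≤ 0`, at no cost.
  by_cases hxB : x ∈ B
  · rcases Nat.eq_or_lt_of_le hn with h1 | h1
    · subst h1
      refine (le_coe_toENNReal (a 1 x)).trans
        (EReal.coe_ennreal_le_coe_ennreal_iff.2 (le_add_right ?_))
      simp [hxB, hd]
    · have h2 := hsub x hx 1 (n - 1) le_rfl (by omega)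
      rw [show 1 + (n - 1) = n by omega] at h2
      refine h2.trans ((add_le_add (le_coe_toENNReal _) (key 1 le_rfl h1)).trans ?_)
      rw [← EReal.coe_ennreal_add, hsplit 1 hn, add_assoc]
      simp [hxB, hd]
  · obtain ⟨m, hm1, hmN, hm0⟩ : ∃ m, 1 ≤ m ∧ m ≤ N ∧ a m x ≤ 0 := by
      simpa [hB] using hxB
    have h2 := hsub x hx m (n - m) hm1 (by omega)
    rw [show m + (n - m) = n by omega] at h2
    refine h2.trans ((add_le_add hm0 (key m hm1 (by omega))).trans ?_)
    rw [zero_add, hsplit m (by omega), add_assoc]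
    exact EReal.coe_ennreal_le_coe_ennreal_iff.2 le_add_self

variable [MeasurableSpace X] {μ : Measure X}

theorem SubadditiveSeq.ae_orbit (hT : Measure.QuasiMeasurePreserving T μ μ) {a : ℕ → X → EReal}
    (ha : SubadditiveSeq μ T a) : ∀ᵐ x ∂μ, ∀ k n m : ℕ, 1 ≤ n → 1 ≤ m →
      a (n + m) (T^[k] x) ≤ a n (T^[k] x) + a m (T^[n] (T^[k] x)) := by
  have h1 : ∀ᵐ x ∂μ, ∀ n m : ℕ, 1 ≤ n → 1 ≤ m → a (n + m) x ≤ a n x + a m (T^[n] x) :=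
    ae_all_iff.2 fun n => ae_all_iff.2 fun m => by
      by_cases hn : 1 ≤ n
      · by_cases hm : 1 ≤ m
        · filter_upwards [ha n m hn hm] with x hx _ _ using hx
        · exact ae_of_all _ fun x _ h => absurd h hm
      · exact ae_of_all _ fun x h => absurd h hn
  exact ae_forall_iterate hT h1

theorem SubadditiveSeq.ae_le_birkhoffSum (hT : Measure.QuasiMeasurePreserving T μ μ)
    {a : ℕ → X → EReal} (ha : SubadditiveSeq μ T a) :
    ∀ᵐ x ∂μ, ∀ n : ℕ, 1 ≤ n →
      a n x ≤ (birkhoffSum T (fun y => (a 1 y).toENNReal) n x : ENNReal) := by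
  filter_upwards [ha.ae_orbit hT] with x hx n hn
  refine le_birkhoffSum_toENNReal (s := Set.range fun k => T^[k] x) ?_ ?_ hn ⟨0, rfl⟩
  · rintro _ ⟨k, rfl⟩
    exact ⟨k + 1, Function.iterate_succ_apply' T k x⟩
  · rintro _ ⟨k, rfl⟩
    exact hx k

theorem SubadditiveSeq.ae_orbit_bound (hT : Measure.QuasiMeasurePreserving T μ μ)
    {a : ℕ → X → EReal} (ha : SubadditiveSeq μ T a) :
    ∀ᵐ x ∂μ, ∀ N n : ℕ, 1 ≤ n →
      a n x ≤ ((birkhoffSum T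
        ({y | ∀ m, 1 ≤ m → m ≤ N → 0 < a m y}.indicator fun y => (a 1 y).toENNReal) n x
      + ∑ k ∈ Finset.Ico (n - N) n, (a 1 (T^[k] x)).toENNReal : ENNReal) : EReal) := by
  filter_upwards [ha.ae_orbit hT] with x hx N n hn
  refine subadditive_orbit_bound (s := Set.range fun k => T^[k] x) ?_ ?_ N hn ⟨0, rfl⟩
  · rintro _ ⟨k, rfl⟩
    exact ⟨k + 1, Function.iterate_succ_apply' T k x⟩
  · rintro _ ⟨k, rfl⟩
    exact hx k

theorem measurableSet_forall_pos {a : ℕ → X → EReal}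
    (ha_meas : ∀ n : ℕ, 1 ≤ n → Measurable (a n)) (N : ℕ) :
    MeasurableSet {y | ∀ m, 1 ≤ m → m ≤ N → 0 < a m y} := by
  have : {y | ∀ m, 1 ≤ m → m ≤ N → 0 < a m y}
      = ⋂ m ∈ Finset.Icc 1 N, {y | 0 < a m y} := by
    ext y; simp
  rw [this]
  exact Finset.measurableSet_biInter _ fun m hm =>
    measurableSet_lt measurable_const (ha_meas m (Finset.mem_Icc.1 hm).1)

/-- Dominated convergence by `(a 1)⁺`: almost every point leaves the decreasing sets at a finite
`N`. -/
theorem tendsto_lintegral_indicator_forall_pos {a : ℕ → X → EReal}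
    (ha_meas : ∀ n : ℕ, 1 ≤ n → Measurable (a n)) (ha_one : PosPartIntegrable μ (a 1))
    (hle : ∀ᵐ x ∂μ, ∃ n : ℕ, 1 ≤ n ∧ a n x ≤ 0) :
    Tendsto (fun N : ℕ => ∫⁻ x, {y | ∀ m, 1 ≤ m → m ≤ N → 0 < a m y}.indicator
      (fun y => (a 1 y).toENNReal) x ∂μ) atTop (𝓝 0) := by
  have hd : Measurable fun y => (a 1 y).toENNReal := (ha_meas 1 le_rfl).ereal_toENNReal
  rw [← lintegral_zero (μ := μ)]
  refine tendsto_lintegral_of_dominated_convergence (fun y => (a 1 y).toENNReal)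
    (fun N => hd.indicator (measurableSet_forall_pos ha_meas N)) (fun N => ae_of_all _ fun x =>
      Set.indicator_le_self _ _ x) ha_one.ne ?_
  filter_upwards [hle] with x ⟨n, hn1, hn⟩
  refine tendsto_const_nhds.congr' ?_
  filter_upwards [eventually_ge_atTop n] with N hN
  rw [Set.indicator_of_notMem]
  exact fun h => absurd (h n hn1 hN) (not_lt.2 hn)

/-- Integrating the orbit bound leaves `n` times a small integral plus at most `N ∫ (a 1)⁺`; fix
`N`, then let `n` grow. -/
theorem SubadditiveSeq.eventually_lintegral_le (hT : MeasurePreserving T μ μ)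
    {a : ℕ → X → EReal} (ha_meas : ∀ n : ℕ, 1 ≤ n → Measurable (a n))
    (ha : SubadditiveSeq μ T a) (ha_one : PosPartIntegrable μ (a 1))
    (hle : ∀ᵐ x ∂μ, ∃ n : ℕ, 1 ≤ n ∧ a n x ≤ 0) {δ : ENNReal} (hδ : δ ≠ 0) :
    ∀ᶠ n : ℕ in atTop, ∫⁻ x, (a n x).toENNReal ∂μ ≤ n * δ := by
  have hd : Measurable fun y => (a 1 y).toENNReal := (ha_meas 1 le_rfl).ereal_toENNReal
  have hδ2 : δ / 2 ≠ 0 := by simpa using hδ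
  obtain ⟨N, hN⟩ := ((tendsto_lintegral_indicator_forall_pos ha_meas ha_one hle).eventually_lt_const
    (pos_iff_ne_zero.2 hδ2)).exists
  set B := {y | ∀ m, 1 ≤ m → m ≤ N → 0 < a m y}
  have hB : MeasurableSet B := measurableSet_forall_pos ha_meas N
  set C := ∫⁻ x, (a 1 x).toENNReal ∂μ
  have hC : (N * C) ≠ ⊤ := ENNReal.mul_ne_top (by simp) ha_one.ne
  have hev : ∀ᶠ n : ℕ in atTop, N * C ≤ n * (δ / 2) := by
    obtain ⟨n₀, hn₀⟩ := ENNReal.exists_nat_mul_gt hδ2 hC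
    filter_upwards [eventually_ge_atTop n₀] with n hn
    exact hn₀.le.trans (mul_le_mul_left (by exact_mod_cast hn) _)
  filter_upwards [hev, eventually_ge_atTop 1] with n hn hn1
  have h1 : ∫⁻ x, (a n x).toENNReal ∂μ ≤ ∫⁻ x, (birkhoffSum T
        (B.indicator fun y => (a 1 y).toENNReal) n x
      + ∑ k ∈ Finset.Ico (n - N) n, (a 1 (T^[k] x)).toENNReal) ∂μ := by
    refine lintegral_mono_ae ?_
    filter_upwards [ha.ae_orbit_bound hT.quasiMeasurePreserving] with x hx
    exact (EReal.toENNReal_le_toENNReal (hx N n hn1)).trans_eq EReal.toENNReal_coe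
  refine h1.trans ?_
  rw [lintegral_add_left (measurable_birkhoffSum hT.measurable (hd.indicator hB) n),
    lintegral_birkhoffSum hT (hd.indicator hB),
    lintegral_finsetSum (f := fun k x => (a 1 (T^[k] x)).toENNReal) _
      fun k _ => hd.comp (hT.measurable.iterate k)]
  have h2 : ∀ k, ∫⁻ x, (a 1 (T^[k] x)).toENNReal ∂μ = C := fun k =>
    (hT.iterate k).lintegral_comp hd
  simp only [h2, Finset.sum_const, Nat.card_Ico, nsmul_eq_mul]
  calc n * ∫⁻ x, B.indicator (fun y => (a 1 y).toENNReal) x ∂μ + ((n - (n - N) : ℕ) : ENNReal) * C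
      ≤ n * (δ / 2) + N * C := by
        refine add_le_add (mul_le_mul_right hN.le _) (mul_le_mul_left ?_ _)
        exact_mod_cast (by omega : n - (n - N) ≤ N)
    _ ≤ n * (δ / 2) + n * (δ / 2) := add_le_add_right hn _
    _ = n * δ := by rw [← mul_add, ENNReal.add_halves]

/-- The factor 2 pays for the two parts of the orbit bound: visits to `B N`, controlled by the
maximal inequality, and the last `N` steps, controlled by Chacon–Ornstein. -/
theorem SubadditiveSeq.ae_eventually_le_birkhoffSum (hT : MeasurePreserving T μ μ)
    {a : ℕ → X → EReal} (ha_meas : ∀ n : ℕ, 1 ≤ n → Measurable (a n))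
    (ha : SubadditiveSeq μ T a) (ha_one : PosPartIntegrable μ (a 1))
    (hle : ∀ᵐ x ∂μ, ∃ n : ℕ, 1 ≤ n ∧ a n x ≤ 0) {g : X → ENNReal} (hg : Measurable g)
    (hg0 : ∀ᵐ x ∂μ, g x ≠ 0) :
    ∀ᵐ x ∂μ, ∀ᶠ n : ℕ in atTop, a n x ≤ ((2 * birkhoffSum T g n x : ENNReal) : EReal) := by
  set d : X → ENNReal := fun y => (a 1 y).toENNReal with hd_def
  have hd : Measurable d := (ha_meas 1 le_rfl).ereal_toENNReal
  set B : ℕ → Set X := fun N => {y | ∀ m, 1 ≤ m → m ≤ N → 0 < a m y} with hB_def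
  have hB : ∀ N, MeasurableSet (B N) := measurableSet_forall_pos ha_meas
  set E : ℕ → Set X := fun N =>
    {x | ∃ n, birkhoffSum T g n x < birkhoffSum T ((B N).indicator d) n x} with hE_def
  have hEm : ∀ N, MeasurableSet (E N) := by
    intro N
    have : E N = ⋃ n, {x | birkhoffSum T g n x < birkhoffSum T ((B N).indicator d) n x} := by
      ext x; simp [hE_def]
    rw [this]
    exact MeasurableSet.iUnion fun n => measurableSet_lt
      (measurable_birkhoffSum hT.measurable hg n)
      (measurable_birkhoffSum hT.measurable (hd.indicator (hB N)) n)
  have hmax : ∀ N, ∫⁻ x in E N, g x ∂μ ≤ ∫⁻ x, (B N).indicator d x ∂μ := fun N =>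
    setLIntegral_maximal_le hT (hd.indicator (hB N)) hg
      (ne_top_of_le_ne_top ha_one.ne (lintegral_mono (Set.indicator_le_self _ _)))
  have hzero : ∫⁻ x in ⋂ N, E N, g x ∂μ = 0 := by
    refine le_antisymm (ge_of_tendsto' (tendsto_lintegral_indicator_forall_pos ha_meas ha_one hle)
      fun N => (lintegral_mono_set (Set.iInter_subset _ N)).trans (hmax N)) zero_le
  have hEnull : ∀ᵐ x ∂μ, ∃ N, x ∉ E N := by
    rw [setLIntegral_eq_zero_iff (MeasurableSet.iInter hEm) hg] at hzero
    filter_upwards [hzero, hg0] with x hx hx0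
    by_contra hcon
    push Not at hcon
    exact hx0 (hx (Set.mem_iInter.2 hcon))
  -- Dividing `g` by `N + 1` lets the at most `N` final terms add up to no more than `S_n g`.
  have htail : ∀ᵐ x ∂μ, ∀ N : ℕ, ∀ᶠ n in atTop,
      d (T^[n] x) ≤ birkhoffSum T (fun y => g y / (N + 1)) n x := by
    refine ae_all_iff.2 fun N => ae_eventually_iterate_le_birkhoffSum hT hd (hg.div_const _)
      ha_one.ne ?_
    filter_upwards [hg0] with x hx
    simp [ENNReal.div_eq_zero_iff, hx]
  filter_upwards [hEnull, htail, ha.ae_orbit_bound hT.quasiMeasurePreserving] with x ⟨N, hN⟩ ht hx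
  obtain ⟨K, hK⟩ := eventually_atTop.1 (ht N)
  filter_upwards [eventually_ge_atTop (K + N + 1)] with n hn
  refine (hx N n (by omega)).trans (EReal.coe_ennreal_le_coe_ennreal_iff.2 ?_)
  rw [two_mul]
  refine add_le_add ?_ ?_
  · by_contra hcon
    exact hN ⟨n, not_le.1 hcon⟩
  · have h1 : ∀ k ∈ Finset.Ico (n - N) n, (a 1 (T^[k] x)).toENNReal
        ≤ birkhoffSum T g n x / (N + 1) := by
      intro k hk
      rw [Finset.mem_Ico] at hk
      refine (hK k (by omega)).trans ?_
      simp only [birkhoffSum, div_eq_mul_inv]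
      rw [← Finset.sum_mul]
      exact mul_le_mul_left (Finset.sum_le_sum_of_subset (by simpa using hk.2.le)) _
    refine (Finset.sum_le_card_nsmul _ _ _ h1).trans ?_
    rw [nsmul_eq_mul, Nat.card_Ico]
    calc ((n - (n - N) : ℕ) : ENNReal) * (birkhoffSum T g n x / (N + 1))
        ≤ (N + 1) * (birkhoffSum T g n x / (N + 1)) := by
          refine mul_le_mul_left ?_ _
          exact_mod_cast (by omega : n - (n - N) ≤ N + 1)
      _ = birkhoffSum T g n x := ENNReal.mul_div_cancel (by simp) (by finiteness)

end Core

/-! ### The extended integral and truncation from below. -/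

section ExtIntegral

variable {X : Type*} [MeasurableSpace X] {μ : Measure X}

theorem extIntegral_mono_ae {f f' : X → EReal} (h : ∀ᵐ x ∂μ, f x ≤ f' x) :
    extIntegral μ f ≤ extIntegral μ f' := by
  refine EReal.sub_le_sub ?_ ?_ <;> refine EReal.coe_ennreal_le_coe_ennreal_iff.2
    (lintegral_mono_ae ?_) <;> filter_upwards [h] with x hx
  · exact EReal.toENNReal_le_toENNReal hx
  · exact EReal.toENNReal_le_toENNReal (EReal.neg_le_neg_iff.2 hx)

theorem extIntegral_congr_ae {f f' : X → EReal} (h : ∀ᵐ x ∂μ, f x = f' x) :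
    extIntegral μ f = extIntegral μ f' :=
  le_antisymm (extIntegral_mono_ae (h.mono fun _ => le_of_eq))
    (extIntegral_mono_ae (h.mono fun _ hx => hx.ge))

theorem PosPartIntegrable.mono_ae {f f' : X → EReal} (hf : PosPartIntegrable μ f')
    (h : ∀ᵐ x ∂μ, f x ≤ f' x) : PosPartIntegrable μ f :=
  (lintegral_mono_ae (h.mono fun _ hx => EReal.toENNReal_le_toENNReal hx)).trans_lt hf

theorem PosPartIntegrable.restrict {f : X → EReal} (hf : PosPartIntegrable μ f) (s : Set X) :
    PosPartIntegrable (μ.restrict s) f :=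
  (setLIntegral_le_lintegral s _).trans_lt hf

theorem PosPartIntegrable.extIntegral_lt_top {f : X → EReal} (hf : PosPartIntegrable μ f) :
    extIntegral μ f < ⊤ := by
  refine (EReal.sub_le_sub le_rfl (EReal.coe_ennreal_nonneg _)).trans_lt ?_
  rw [sub_zero, ← EReal.coe_ennreal_top]
  exact EReal.coe_ennreal_lt_coe_ennreal_iff.2 hf

theorem MeasureTheory.Integrable.posPartIntegrable {f : X → ℝ} (hf : Integrable f μ) :
    PosPartIntegrable μ fun x => (f x : EReal) := by
  simpa [PosPartIntegrable] using hf.lintegral_lt_top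

theorem extIntegral_coe {f : X → ℝ} (hf : Integrable f μ) :
    extIntegral μ (fun x => (f x : EReal)) = (∫ x, f x ∂μ : ℝ) := by
  rw [integral_eq_lintegral_pos_part_sub_lintegral_neg_part hf, EReal.coe_sub]
  have h1 := hf.lintegral_lt_top.ne
  have h2 := hf.neg.lintegral_lt_top.ne
  simp only [Pi.neg_apply] at h2
  rw [EReal.coe_ennreal_toReal h1, EReal.coe_ennreal_toReal h2]
  rfl

theorem integrable_toReal_of_posPart_of_negPart {f : X → EReal} (hf : Measurable f)
    (hp : ∫⁻ x, (f x).toENNReal ∂μ ≠ ⊤) (hn : ∫⁻ x, (-f x).toENNReal ∂μ ≠ ⊤) :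
    Integrable (fun x => (f x).toReal) μ ∧ ∀ᵐ x ∂μ, f x = ((f x).toReal : EReal) := by
  have h1 : ∀ᵐ x ∂μ, f x ≠ ⊤ ∧ f x ≠ ⊥ := by
    filter_upwards [ae_lt_top hf.ereal_toENNReal hp, ae_lt_top hf.neg.ereal_toENNReal hn]
      with x h1 h2
    exact ⟨EReal.toENNReal_ne_top_iff.1 h1.ne, fun h => by simp [h] at h2⟩
  refine ⟨?_, h1.mono fun x hx => (EReal.coe_toReal hx.1 hx.2).symm⟩
  refine ((integrable_toReal_of_lintegral_ne_top hf.ereal_toENNReal.aemeasurable hp).sub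
    (integrable_toReal_of_lintegral_ne_top hf.neg.ereal_toENNReal.aemeasurable hn)).congr ?_
  filter_upwards [h1] with x hx
  simp only [Pi.sub_apply, Pi.neg_apply]
  generalize f x = z at hx ⊢
  lift z to ℝ using hx with y
  simp only [← EReal.coe_neg, EReal.real_coe_toENNReal, EReal.toReal_coe]
  rcases le_total 0 y with h | h
  · simp [ENNReal.toReal_ofReal', h]
  · simp [ENNReal.toReal_ofReal', h]

theorem extIntegral_le_of_lintegral_sub_le {f : X → EReal} (hf : Measurable f) {ψ : X → ℝ}
    (hψ : Measurable ψ) (hψi : Integrable ψ μ) {δ : ENNReal} (hδ : δ ≠ ⊤)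
    (h : ∫⁻ x, (f x - ψ x).toENNReal ∂μ ≤ δ) :
    extIntegral μ f ≤ ((∫ x, ψ x ∂μ + δ.toReal : ℝ) : EReal) := by
  have hm : Measurable fun x => (f x - (ψ x : EReal)).toENNReal :=
    (hf.sub hψ.coe_real_ereal).ereal_toENNReal
  have hne := ne_top_of_le_ne_top hδ h
  have hi := integrable_toReal_of_lintegral_ne_top hm.aemeasurable hne
  have hlt := ae_lt_top hm hne
  have h1 : extIntegral μ f
      ≤ extIntegral μ fun x => ((ψ x + (f x - ψ x).toENNReal.toReal : ℝ) : EReal) := by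
    refine extIntegral_mono_ae ?_
    filter_upwards [hlt] with x hx
    rw [EReal.coe_add, EReal.coe_ennreal_toReal hx.ne, add_comm]
    have := add_le_add_left (le_coe_toENNReal (f x - ψ x)) (ψ x : EReal)
    rwa [EReal.sub_add_cancel] at this
  refine h1.trans ?_
  rw [extIntegral_coe (f := fun x => ψ x + (f x - ψ x).toENNReal.toReal) (hψi.add hi),
    integral_add hψi hi, integral_toReal hm.aemeasurable hlt]
  exact EReal.coe_le_coe_iff.2 (add_le_add_right (ENNReal.toReal_mono hδ h) _)

/-- The floor is negative, so it leaves the positive part unchanged, while the negative part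
converges monotonically. A multiple of `w` replaces a constant floor, since constants need not be
integrable when the measure is infinite. -/
theorem tendsto_extIntegral_max {f : X → EReal} (hf : Measurable f)
    (hp : PosPartIntegrable μ f) {w : X → ℝ} (hw : Measurable w) (hw0 : ∀ x, 0 < w x) :
    Tendsto (fun R : ℕ => extIntegral μ fun x => max (f x) ((-(R * w x) : ℝ) : EReal)) atTop
      (𝓝 (extIntegral μ f)) := by
  have hpos : ∀ (R : ℕ) x, (max (f x) ((-(R * w x) : ℝ) : EReal)).toENNReal
      = (f x).toENNReal := by
    intro R x
    have h0 : ((-(R * w x) : ℝ) : EReal) ≤ 0 := by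
      exact_mod_cast neg_nonpos.2 (mul_nonneg R.cast_nonneg (hw0 x).le)
    rcases le_total (f x) 0 with h | h
    · rw [EReal.toENNReal_of_nonpos h, EReal.toENNReal_of_nonpos (max_le h h0)]
    · rw [max_eq_left (h0.trans h)]
  unfold extIntegral
  simp only [hpos, sub_eq_add_neg]
  have hneg : Tendsto (fun R : ℕ => ∫⁻ x, (-max (f x) ((-(R * w x) : ℝ) : EReal)).toENNReal ∂μ)
      atTop (𝓝 (∫⁻ x, (-f x).toENNReal ∂μ)) := by
    refine lintegral_tendsto_of_tendsto_of_monotone (fun R => ?_) (ae_of_all _ fun x => ?_)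
      (ae_of_all _ fun x => ?_)
    · exact ((hf.max (hw.const_mul _).neg.coe_real_ereal).neg.ereal_toENNReal).aemeasurable
    · intro R R' hR
      refine EReal.toENNReal_le_toENNReal (EReal.neg_le_neg_iff.2 (max_le_max le_rfl ?_))
      rw [EReal.coe_le_coe_iff]
      exact neg_le_neg (mul_le_mul_of_nonneg_right (by exact_mod_cast hR) (hw0 x).le)
    · have h1 : Tendsto (fun R : ℕ => ((-(R * w x) : ℝ) : EReal)) atTop (𝓝 ⊥) := by
        refine EReal.tendsto_coe_nhds_bot_iff.2 (tendsto_neg_atTop_atBot.comp ?_)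
        exact tendsto_natCast_atTop_atTop.atTop_mul_const (hw0 x)
      have h2 := (tendsto_const_nhds (x := f x)).max h1
      rw [max_bot_right] at h2
      exact (EReal.continuous_toENNReal.comp continuous_neg).continuousAt.tendsto.comp h2
  -- Subtraction is continuous here because the positive part has finite integral, which excludes `⊤
  -- - ⊤`.
  have hc : ContinuousAt (fun y : ENNReal =>
      ((∫⁻ x, (f x).toENNReal ∂μ : ENNReal) : EReal) + -(y : EReal))
      (∫⁻ x, (-f x).toENNReal ∂μ) := by
    have h1 := EReal.continuousAt_add (p := (((∫⁻ x, (f x).toENNReal ∂μ : ENNReal) : EReal),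
      -((∫⁻ x, (-f x).toENNReal ∂μ : ENNReal) : EReal)))
      (Or.inl (by simpa using hp.ne)) (Or.inl (by simp))
    exact ContinuousAt.comp (f := fun y : ENNReal =>
      (((∫⁻ x, (f x).toENNReal ∂μ : ENNReal) : EReal), -(y : EReal))) h1
      (continuous_const.prodMk (continuous_neg.comp continuous_coe_ennreal_ereal)).continuousAt
  exact hc.tendsto.comp hneg

end ExtIntegral

/-! ### Comparison of a subadditive sequence with Birkhoff sums. -/

section Compare

variable {X : Type*} [MeasurableSpace X] {μ : Measure X} {T : X → X}

theorem integral_birkhoffSum (hT : MeasurePreserving T μ μ) {ψ : X → ℝ} (hψ : Integrable ψ μ)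
    (n : ℕ) : Integrable (birkhoffSum T ψ n) μ ∧
      ∫ x, birkhoffSum T ψ n x ∂μ = n * ∫ x, ψ x ∂μ := by
  have hk : ∀ k, Integrable (fun x => ψ (T^[k] x)) μ := fun k =>
    (hT.iterate k).integrable_comp_of_integrable hψ
  have hk' : ∀ k, ∫ x, ψ (T^[k] x) ∂μ = ∫ x, ψ x ∂μ := fun k => by
    conv_rhs => rw [← (hT.iterate k).map_eq]
    exact (integral_map (hT.iterate k).aemeasurable
      ((hT.iterate k).map_eq.symm ▸ hψ.aestronglyMeasurable)).symm
  refine ⟨integrable_finsetSum _ fun k _ => hk k, ?_⟩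
  simp only [birkhoffSum]
  rw [integral_finsetSum _ fun k _ => hk k]
  simp [hk']

theorem SubadditiveSeq.sub_birkhoffSum {a : ℕ → X → EReal} (ha : SubadditiveSeq μ T a)
    (ψ : X → ℝ) : SubadditiveSeq μ T fun n x => a n x - (birkhoffSum T ψ n x : ℝ) := by
  intro n m hn hm
  filter_upwards [ha n m hn hm] with x hx
  rw [birkhoffSum_add, EReal.coe_add, ← EReal.add_sub_add_comm (by simp) (by simp)]
  exact EReal.sub_le_sub hx le_rfl

theorem PosPartIntegrable.sub_integrable {f : X → EReal} (hf : PosPartIntegrable μ f)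
    {ψ : X → ℝ} (hψ : Measurable ψ) (hψi : Integrable ψ μ) :
    PosPartIntegrable μ fun x => f x - ψ x := by
  unfold PosPartIntegrable
  calc ∫⁻ x, (f x - ψ x).toENNReal ∂μ ≤ ∫⁻ x, (f x).toENNReal + ENNReal.ofReal (-ψ x) ∂μ := by
        refine lintegral_mono fun x => ?_
        rw [sub_eq_add_neg]
        exact EReal.toENNReal_add_le
    _ = ∫⁻ x, (f x).toENNReal ∂μ + ∫⁻ x, ENNReal.ofReal (-ψ x) ∂μ :=
        lintegral_add_right _ hψ.neg.ennreal_ofReal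
    _ < ⊤ := ENNReal.add_lt_top.2 ⟨hf, hψi.neg.lintegral_lt_top⟩

theorem SubadditiveSeq.eventually_lintegral_sub_birkhoffSum_le (hT : MeasurePreserving T μ μ)
    {a : ℕ → X → EReal} (ha_meas : ∀ n : ℕ, 1 ≤ n → Measurable (a n))
    (ha : SubadditiveSeq μ T a) (ha_one : PosPartIntegrable μ (a 1)) {ψ : X → ℝ}
    (hψ : Measurable ψ) (hψi : Integrable ψ μ)
    (hle : ∀ᵐ x ∂μ, ∃ n : ℕ, 1 ≤ n ∧ a n x ≤ (birkhoffSum T ψ n x : ℝ))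
    {δ : ENNReal} (hδ : δ ≠ 0) :
    ∀ᶠ n : ℕ in atTop, ∫⁻ x, (a n x - (birkhoffSum T ψ n x : ℝ)).toENNReal ∂μ ≤ n * δ := by
  refine (ha.sub_birkhoffSum ψ).eventually_lintegral_le hT
    (fun n hn => (ha_meas n hn).sub (measurable_birkhoffSum hT.measurable hψ n).coe_real_ereal)
    ?_ ?_ hδ
  · simp only [birkhoffSum_one]
    exact ha_one.sub_integrable hψ hψi
  · filter_upwards [hle] with x ⟨n, hn, hx⟩
    exact ⟨n, hn, EReal.sub_nonpos.2 hx⟩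

theorem SubadditiveSeq.ae_eventually_le_birkhoffSum_add (hT : MeasurePreserving T μ μ)
    {a : ℕ → X → EReal} (ha_meas : ∀ n : ℕ, 1 ≤ n → Measurable (a n))
    (ha : SubadditiveSeq μ T a) (ha_one : PosPartIntegrable μ (a 1)) {ψ : X → ℝ}
    (hψ : Measurable ψ) (hψi : Integrable ψ μ)
    (hle : ∀ᵐ x ∂μ, ∃ n : ℕ, 1 ≤ n ∧ a n x ≤ (birkhoffSum T ψ n x : ℝ))
    {g : X → ℝ} (hg : Measurable g) (hg0 : ∀ x, 0 < g x) :
    ∀ᵐ x ∂μ, ∀ᶠ n : ℕ in atTop,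
      a n x ≤ ((birkhoffSum T ψ n x + birkhoffSum T g n x : ℝ) : EReal) := by
  have h := (ha.sub_birkhoffSum ψ).ae_eventually_le_birkhoffSum hT
    (fun n hn => (ha_meas n hn).sub (measurable_birkhoffSum hT.measurable hψ n).coe_real_ereal)
    (by simp only [birkhoffSum_one]; exact ha_one.sub_integrable hψ hψi)
    (by
      filter_upwards [hle] with x ⟨n, hn, hx⟩
      exact ⟨n, hn, EReal.sub_nonpos.2 hx⟩)
    -- Halving `g` absorbs the factor 2 of the previous bound.
    (g := fun x => ENNReal.ofReal (g x / 2)) (hg.div_const 2).ennreal_ofReal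
    (ae_of_all _ fun x => by simpa using hg0 x)
  filter_upwards [h] with x hx
  filter_upwards [hx] with n hn
  have e : (2 * birkhoffSum T (fun x => ENNReal.ofReal (g x / 2)) n x : ENNReal)
      = ENNReal.ofReal (birkhoffSum T g n x) := by
    simp only [birkhoffSum]
    rw [← ENNReal.ofReal_sum_of_nonneg fun k _ => (half_pos (hg0 _)).le, ← Finset.sum_div,
      ← ENNReal.ofReal_ofNat, ← ENNReal.ofReal_mul (by norm_num)]
    congr 1
    ring
  have hnn : 0 ≤ birkhoffSum T g n x := Finset.sum_nonneg fun k _ => (hg0 _).le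
  rw [e, EReal.coe_ennreal_ofReal, max_eq_left hnn] at hn
  have := add_le_add_left hn ((birkhoffSum T ψ n x : ℝ) : EReal)
  simp only [Pi.sub_apply] at this
  rwa [EReal.sub_add_cancel, ← EReal.coe_add, add_comm] at this

/-- Apply the integral estimate to the additive sequence `S_n ψ`: its integral is `n ∫ ψ`, while its
positive part has integral `o(n)`. -/
theorem integral_nonpos_of_exists_birkhoffSum_nonpos (hT : MeasurePreserving T μ μ) {ψ : X → ℝ}
    (hψ : Measurable ψ) (hψi : Integrable ψ μ)
    (hle : ∀ᵐ x ∂μ, ∃ n : ℕ, 1 ≤ n ∧ birkhoffSum T ψ n x ≤ 0) : ∫ x, ψ x ∂μ ≤ 0 := by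
  by_contra! hc
  set c := ∫ x, ψ x ∂μ
  have hsub : SubadditiveSeq μ T fun n x => ((birkhoffSum T ψ n x : ℝ) : EReal) :=
    fun n m _ _ => ae_of_all _ fun x => by
      simp only [birkhoffSum_add, EReal.coe_add, le_refl]
  have hev := hsub.eventually_lintegral_le hT
    (fun n _ => (measurable_birkhoffSum hT.measurable hψ n).coe_real_ereal)
    (by simpa using hψi.posPartIntegrable)
    (by
      filter_upwards [hle] with x ⟨n, hn, hx⟩
      exact ⟨n, hn, by exact_mod_cast hx⟩)
    (δ := ENNReal.ofReal (c / 2)) (by simpa using hc)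
  obtain ⟨n, hn, hn1⟩ := (hev.and (eventually_ge_atTop 1)).exists
  obtain ⟨hi, he⟩ := integral_birkhoffSum hT hψi n
  have h1 : ∫ x, birkhoffSum T ψ n x ∂μ ≤ n * (c / 2) := by
    rw [integral_eq_lintegral_pos_part_sub_lintegral_neg_part hi]
    refine (sub_le_self _ ENNReal.toReal_nonneg).trans ?_
    refine (ENNReal.toReal_mono (by finiteness) hn).trans_eq ?_
    rw [ENNReal.toReal_mul, ENNReal.toReal_ofReal (by positivity), ENNReal.toReal_natCast]
  rw [he] at h1
  have : (1 : ℝ) ≤ n := by exact_mod_cast hn1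
  nlinarith

end Compare

/-! ### Invariance of the lower limit and integrability of `(h g)⁺`. -/

section Ratio

variable {X : Type*} {T : X → X}

theorem birkhoffSum_pos {g : X → ℝ} (hg0 : ∀ x, 0 < g x) {n : ℕ} (hn : 1 ≤ n) (x : X) :
    0 < birkhoffSum T g n x :=
  Finset.sum_pos (fun k _ => hg0 _) (Finset.nonempty_range_iff.2 (by omega))

theorem birkhoffSum_mul_of_invariant {φ g : X → ℝ} {x : X} (h : ∀ k, φ (T^[k] x) = φ x) (n : ℕ) :
    birkhoffSum T (fun y => φ y * g y) n x = φ x * birkhoffSum T g n x := by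
  simp [birkhoffSum, h, Finset.mul_sum]

/-- The lower limit of `a n / S_n g`, over `n ≥ 1`. -/
noncomputable def ratioLiminf (T : X → X) (a : ℕ → X → EReal) (g : X → ℝ) (x : X) : EReal :=
  liminf (fun n : ℕ => a (n + 1) x / ((birkhoffSum T g (n + 1) x : ℝ) : EReal)) atTop

theorem eventually_lt_of_lt_ratioLiminf {a : ℕ → X → EReal} {g : X → ℝ} {x : X} {c : EReal}
    (h : c < ratioLiminf T a g x) :
    ∀ᶠ n : ℕ in atTop, c < a n x / ((birkhoffSum T g n x : ℝ) : EReal) := by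
  have h1 := eventually_lt_of_lt_liminf h
  obtain ⟨K, hK⟩ := eventually_atTop.1 h1
  filter_upwards [eventually_ge_atTop (K + 1)] with n hn
  have := hK (n - 1) (by omega)
  rwa [Nat.sub_add_cancel (by omega)] at this

theorem lt_div_birkhoffSum_iff {g : X → ℝ} (hg0 : ∀ x, 0 < g x) {n : ℕ} (hn : 1 ≤ n) (x : X)
    (y : EReal) (c : ℝ) : (c : EReal) < y / ((birkhoffSum T g n x : ℝ) : EReal)
      ↔ ((c * birkhoffSum T g n x : ℝ) : EReal) < y := by
  rw [EReal.lt_div_iff (by exact_mod_cast birkhoffSum_pos hg0 hn x) (EReal.coe_ne_top _),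
    EReal.coe_mul]

theorem div_birkhoffSum_le_iff {g : X → ℝ} (hg0 : ∀ x, 0 < g x) {n : ℕ} (hn : 1 ≤ n) (x : X)
    (y : EReal) (c : ℝ) : y / ((birkhoffSum T g n x : ℝ) : EReal) ≤ c
      ↔ y ≤ ((c * birkhoffSum T g n x : ℝ) : EReal) := by
  rw [← not_lt, lt_div_birkhoffSum_iff hg0 hn, not_lt]

theorem eventually_mul_lt_of_lt_ratioLiminf {a : ℕ → X → EReal} {g : X → ℝ}
    (hg0 : ∀ x, 0 < g x) {x : X} {c : ℝ} (h : (c : EReal) < ratioLiminf T a g x) :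
    ∀ᶠ n : ℕ in atTop, ((c * birkhoffSum T g n x : ℝ) : EReal) < a n x := by
  filter_upwards [eventually_lt_of_lt_ratioLiminf h, eventually_ge_atTop 1] with n h1 hn
  exact (lt_div_birkhoffSum_iff hg0 hn x _ c).1 h1

theorem frequently_le_mul_of_ratioLiminf_lt {a : ℕ → X → EReal} {g : X → ℝ}
    (hg0 : ∀ x, 0 < g x) {x : X} {c : ℝ} (h : ratioLiminf T a g x < c) :
    ∃ᶠ n : ℕ in atTop, 1 ≤ n ∧ a n x ≤ ((c * birkhoffSum T g n x : ℝ) : EReal) := by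
  have h1 := frequently_lt_of_liminf_lt (by isBoundedDefault) h
  rw [frequently_atTop] at h1 ⊢
  intro K
  obtain ⟨n, hn, h2⟩ := h1 K
  exact ⟨n + 1, by omega, by omega, (div_birkhoffSum_le_iff hg0 (by omega) x _ c).1 h2.le⟩

variable [MeasurableSpace X] {μ : Measure X}

theorem measurable_ratioLiminf (hT : Measurable T) {a : ℕ → X → EReal}
    (ha_meas : ∀ n : ℕ, 1 ≤ n → Measurable (a n)) {g : X → ℝ} (hg : Measurable g) :
    Measurable (ratioLiminf T a g) :=
  Measurable.liminf fun n => (ha_meas (n + 1) (by omega)).mul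
    (measurable_birkhoffSum hT hg (n + 1)).inv.coe_real_ereal

/-- Almost every orbit returns infinitely often to a set `{g > 1/(j+1)}` containing its starting
point, so the terms cannot tend to 0. -/
theorem MeasureTheory.Conservative.ae_tendsto_birkhoffSum_atTop (hcons : Conservative T μ)
    {g : X → ℝ} (hg : Measurable g) (hg0 : ∀ x, 0 < g x) :
    ∀ᵐ x ∂μ, Tendsto (fun n => birkhoffSum T g n x) atTop atTop := by
  have h1 : ∀ᵐ x ∂μ, ∀ j : ℕ, x ∈ {y | 1 / ((j : ℝ) + 1) < g y} →
      ∃ᶠ n in atTop, T^[n] x ∈ {y | 1 / ((j : ℝ) + 1) < g y} :=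
    ae_all_iff.2 fun j => hcons.ae_mem_imp_frequently_image_mem
      (measurableSet_lt measurable_const hg).nullMeasurableSet
  filter_upwards [h1] with x hx
  obtain ⟨j, hj⟩ := exists_nat_one_div_lt (hg0 x)
  refine (not_summable_iff_tendsto_nat_atTop_of_nonneg fun k => (hg0 (T^[k] x)).le).1 fun hs => ?_
  have h2 := hs.tendsto_atTop_zero.eventually_lt_const
    (show (0 : ℝ) < 1 / ((j : ℝ) + 1) by positivity)
  obtain ⟨n, hn1, hn2⟩ := ((hx j hj).and_eventually h2).exists
  exact lt_asymm hn1 hn2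

/-- If `h x < q < h (T x)`, recurrence brings the orbit back to `{h < q}`, but `h` is nondecreasing
along the orbit and already exceeds `q`. -/
theorem MeasureTheory.Conservative.ae_comp_eq_of_ae_le_comp (hcons : Conservative T μ)
    {h : X → EReal} (hm : Measurable h) (hle : ∀ᵐ x ∂μ, h x ≤ h (T x)) :
    ∀ᵐ x ∂μ, h (T x) = h x := by
  have hT := hcons.measurable
  have h1 : ∀ᵐ x ∂μ, ∀ q : ℚ, x ∈ {y | h y < (q : ℝ) ∧ ((q : ℝ) : EReal) < h (T y)} →
      ∃ᶠ n in atTop, T^[n] x ∈ {y | h y < (q : ℝ) ∧ ((q : ℝ) : EReal) < h (T y)} :=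
    ae_all_iff.2 fun q => hcons.ae_mem_imp_frequently_image_mem
      ((measurableSet_lt hm measurable_const).inter
        (measurableSet_lt measurable_const (hm.comp hT))).nullMeasurableSet
  filter_upwards [h1, ae_forall_iterate hcons.toQuasiMeasurePreserving hle, hle] with x hx hmono hx0
  refine le_antisymm (not_lt.1 fun hlt => ?_) hx0
  obtain ⟨q, hq1, hq2⟩ := EReal.lt_iff_exists_rat_btwn.1 hlt
  obtain ⟨n, hn, hn1⟩ := ((hx q ⟨hq1, hq2⟩).and_eventually (eventually_ge_atTop 1)).exists
  have hmon : ∀ n, 1 ≤ n → h (T x) ≤ h (T^[n] x) := by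
    intro n hn
    induction n, hn using Nat.le_induction with
    | base => simp
    | succ n _ ih => exact ih.trans (by rw [Function.iterate_succ_apply']; exact hmono n)
  exact absurd (hq2.trans_le (hmon n hn1)) (not_lt.2 hn.1.le)

theorem SubadditiveSeq.ae_ratioLiminf_iterate_eq (hT : MeasurePreserving T μ μ)
    (hcons : Conservative T μ) {a : ℕ → X → EReal}
    (ha_meas : ∀ n : ℕ, 1 ≤ n → Measurable (a n)) (ha : SubadditiveSeq μ T a)
    (ha_one : PosPartIntegrable μ (a 1)) {g : X → ℝ} (hg : Measurable g) (hg0 : ∀ x, 0 < g x) :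
    ∀ᵐ x ∂μ, ∀ k : ℕ, ratioLiminf T a g (T^[k] x) = ratioLiminf T a g x := by
  have hq := hT.quasiMeasurePreserving
  have hle : ∀ᵐ x ∂μ, ratioLiminf T a g x ≤ ratioLiminf T a g (T x) := by
    filter_upwards [ha.ae_orbit hq, hq.ae (hcons.ae_tendsto_birkhoffSum_atTop hg hg0),
      ae_lt_top (ha_meas 1 le_rfl).ereal_toENNReal ha_one.ne] with x hsub hinf hfin
    refine EReal.le_of_forall_lt_iff_le.1 fun z hz => ?_
    obtain ⟨c, hc1, hc2⟩ := EReal.lt_iff_exists_real_btwn.1 hz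
    rw [EReal.coe_lt_coe_iff] at hc2
    have hA : a 1 x ≤ (((a 1 x).toENNReal.toReal : ℝ) : EReal) := by
      rw [EReal.coe_ennreal_toReal hfin.ne]
      exact le_coe_toENNReal _
    set A := (a 1 x).toENNReal.toReal
    -- Beyond this threshold for `S = S_n g (T x)`, `A + c S ≤ z (g x + S)`, so `a 1 x` no longer
    -- matters.
    have hev := hinf.eventually_ge_atTop ((A - z * g x) / (z - c))
    have hfr := (frequently_le_mul_of_ratioLiminf_lt hg0 hc1).and_eventually hev
    refine liminf_le_of_frequently_le (hfr.mono fun n hn => ?_) (by isBoundedDefault)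
    obtain ⟨⟨hn1, hn2⟩, hn3⟩ := hn
    rw [div_birkhoffSum_le_iff hg0 (by omega)]
    have h1 := hsub 0 1 n le_rfl hn1
    simp only [Function.iterate_zero, id_eq, Function.iterate_one] at h1
    rw [add_comm n 1]
    refine h1.trans ((add_le_add hA hn2).trans ?_)
    rw [add_comm 1 n, birkhoffSum_succ', ← EReal.coe_add, EReal.coe_le_coe_iff]
    rw [div_le_iff₀ (by linarith)] at hn3
    linarith
  have h1 := hcons.ae_comp_eq_of_ae_le_comp (measurable_ratioLiminf hT.measurable ha_meas hg) hle
  filter_upwards [ae_forall_iterate hq h1] with x hx k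
  induction k with
  | zero => rfl
  | succ k ih => rw [Function.iterate_succ_apply', hx k, ih]

theorem SubadditiveSeq.posPartIntegrable (hT : MeasurePreserving T μ μ) {a : ℕ → X → EReal}
    (ha_meas : ∀ n : ℕ, 1 ≤ n → Measurable (a n)) (ha : SubadditiveSeq μ T a)
    (ha_one : PosPartIntegrable μ (a 1)) {n : ℕ} (hn : 1 ≤ n) : PosPartIntegrable μ (a n) := by
  have hd : Measurable fun y => (a 1 y).toENNReal := (ha_meas 1 le_rfl).ereal_toENNReal
  have h1 : ∫⁻ x, (a n x).toENNReal ∂μ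
      ≤ ∫⁻ x, birkhoffSum T (fun y => (a 1 y).toENNReal) n x ∂μ := by
    refine lintegral_mono_ae ?_
    filter_upwards [ha.ae_le_birkhoffSum hT.quasiMeasurePreserving] with x hx
    exact (EReal.toENNReal_le_toENNReal (hx n hn)).trans_eq EReal.toENNReal_coe
  rw [lintegral_birkhoffSum hT hd] at h1
  exact h1.trans_lt (ENNReal.mul_lt_top (by simp) ha_one)

/-- Let `u = min h⁺ K`. Where `h > 0`, `u - 1 < h` gives `(u - 1) S_n g < a n ≤ S_n (a 1)⁺` for
large `n`; where `h ≤ 0`, `u = 0` and `n = 1` suffices. Hence `∫ u g ≤ ∫ (a 1)⁺ + ∫ g` uniformly in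
`K`. -/
theorem SubadditiveSeq.posPartIntegrable_ratioLiminf_mul (hT : MeasurePreserving T μ μ)
    (hcons : Conservative T μ) {a : ℕ → X → EReal}
    (ha_meas : ∀ n : ℕ, 1 ≤ n → Measurable (a n)) (ha : SubadditiveSeq μ T a)
    (ha_one : PosPartIntegrable μ (a 1)) {g : X → ℝ} (hg : Measurable g)
    (hgi : Integrable g μ) (hg0 : ∀ x, 0 < g x) :
    PosPartIntegrable μ fun x => ratioLiminf T a g x * (g x : EReal) := by
  set h := ratioLiminf T a g with hh
  have hm : Measurable h := measurable_ratioLiminf hT.measurable ha_meas hg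
  have hd : Measurable fun y => (a 1 y).toENNReal := (ha_meas 1 le_rfl).ereal_toENNReal
  set f : X → ℝ := fun x => (a 1 x).toENNReal.toReal with hf
  have hfm : Measurable f := hd.ennreal_toReal
  have hfi : Integrable f μ := integrable_toReal_of_lintegral_ne_top hd.aemeasurable ha_one.ne
  have hfin := ae_forall_iterate hT.quasiMeasurePreserving (ae_lt_top hd ha_one.ne)
  have hbound : ∀ K : ℕ, ∫⁻ x, min (h x).toENNReal K * ENNReal.ofReal (g x) ∂μ
      ≤ ENNReal.ofReal (∫ x, f x ∂μ + ∫ x, g x ∂μ) := by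
    intro K
    set u : X → ℝ := fun x => (min (h x).toENNReal K).toReal with hu
    have hmin : ∀ x, min (h x).toENNReal (K : ENNReal) ≠ ⊤ := fun x =>
      ne_top_of_le_ne_top (ENNReal.natCast_ne_top K) (min_le_right _ _)
    have hum : Measurable u := (hm.ereal_toENNReal.min measurable_const).ennreal_toReal
    have hu0 : ∀ x, 0 ≤ u x := fun x => ENNReal.toReal_nonneg
    have huK : ∀ x, u x ≤ K := fun x => by
      simpa using ENNReal.toReal_mono (ENNReal.natCast_ne_top K) (min_le_right (h x).toENNReal K)
    have hugi : Integrable (fun x => u x * g x) μ := by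
      refine hgi.bdd_mul (c := K) hum.aestronglyMeasurable (ae_of_all _ fun x => ?_)
      rw [Real.norm_of_nonneg (hu0 x)]
      exact huK x
    have hφgi : Integrable (fun x => (u x - 1) * g x) μ := by
      refine (hugi.sub hgi).congr (ae_of_all _ fun x => ?_)
      simp only [Pi.sub_apply]
      ring
    have hint := integral_nonpos_of_exists_birkhoffSum_nonpos hT
      (((hum.sub_const 1).mul hg).sub hfm) (hφgi.sub hfi) (by
        filter_upwards [ha.ae_ratioLiminf_iterate_eq hT hcons ha_meas ha_one hg hg0,
          ha.ae_le_birkhoffSum hT.quasiMeasurePreserving, hfin] with x hinv hle hfx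
        have hS : ∀ n, birkhoffSum T ((fun y => (u y - 1) * g y) - f) n x
            = (u x - 1) * birkhoffSum T g n x - birkhoffSum T f n x := by
          intro n
          rw [← birkhoffSum_mul_of_invariant (φ := fun y => u y - 1) (fun k => ?_) n]
          · simp [birkhoffSum]
          · simp only [hu, hh, hinv k]
        have hcoe : ∀ n, ((birkhoffSum T (fun y => (a 1 y).toENNReal) n x : ENNReal) : EReal)
            = ((birkhoffSum T f n x : ℝ) : EReal) := by
          intro n
          simp only [birkhoffSum, hf]
          rw [← ENNReal.toReal_sum fun k _ => (hfx k).ne, EReal.coe_ennreal_toReal]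
          exact ENNReal.sum_ne_top.2 fun k _ => (hfx k).ne
        change ∃ n : ℕ, 1 ≤ n ∧ birkhoffSum T ((fun y => (u y - 1) * g y) - f) n x ≤ 0
        simp only [hS]
        rcases le_or_gt (h x) 0 with h0 | h0
        · refine ⟨1, le_rfl, ?_⟩
          have : u x = 0 := by simp [hu, EReal.toENNReal_of_nonpos h0]
          have h2 : 0 ≤ f x := ENNReal.toReal_nonneg
          simp only [this, birkhoffSum_one]
          linarith [hg0 x]
        · have hlt : ((u x - 1 : ℝ) : EReal) < h x := by
            have h3 : ((u x : ℝ) : EReal) ≤ h x := by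
              rw [hu, EReal.coe_ennreal_toReal (hmin x), ← EReal.coe_toENNReal h0.le]
              refine EReal.coe_ennreal_le_coe_ennreal_iff.2 ?_
              rw [EReal.toENNReal_coe]
              exact min_le_left _ _
            exact (EReal.coe_lt_coe_iff.2 (by linarith)).trans_le h3
          obtain ⟨n, hn, hn1⟩ := ((eventually_mul_lt_of_lt_ratioLiminf hg0 hlt).and
            (eventually_ge_atTop 1)).exists
          refine ⟨n, hn1, ?_⟩
          have := hn.trans_le (hle n hn1)
          rw [hcoe, EReal.coe_lt_coe_iff] at this
          linarith)
    have h4 : ∫ x, u x * g x ∂μ ≤ ∫ x, f x ∂μ + ∫ x, g x ∂μ := by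
      have e : ∫ x, ((u x - 1) * g x - f x) ∂μ
          = ∫ x, u x * g x ∂μ - ∫ x, g x ∂μ - ∫ x, f x ∂μ := by
        rw [integral_sub hφgi hfi, ← integral_sub hugi hgi]
        simp only [sub_one_mul]
      have h5 : ∫ x, ((u x - 1) * g x - f x) ∂μ ≤ 0 := hint
      linarith
    refine le_trans (le_of_eq ?_) (ENNReal.ofReal_le_ofReal h4)
    rw [ofReal_integral_eq_lintegral_ofReal hugi
      (ae_of_all _ fun x => mul_nonneg (hu0 x) (hg0 x).le)]
    refine lintegral_congr fun x => ?_
    rw [ENNReal.ofReal_mul (hu0 x), ENNReal.ofReal_toReal (hmin x)]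
  have hlim : Tendsto (fun K : ℕ => ∫⁻ x, min (h x).toENNReal K * ENNReal.ofReal (g x) ∂μ) atTop
      (𝓝 (∫⁻ x, (h x * (g x : EReal)).toENNReal ∂μ)) := by
    refine lintegral_tendsto_of_tendsto_of_monotone (fun K => ?_) (ae_of_all _ fun x => ?_)
      (ae_of_all _ fun x => ?_)
    · exact ((hm.ereal_toENNReal.min measurable_const).mul hg.ennreal_ofReal).aemeasurable
    · intro K K' hK
      exact mul_le_mul_left (min_le_min le_rfl (by exact_mod_cast hK)) _
    · have h1 := (tendsto_const_nhds (x := (h x).toENNReal)).min ENNReal.tendsto_nat_nhds_top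
      rw [min_eq_left le_top] at h1
      rw [EReal.toENNReal_mul' (by exact_mod_cast (hg0 x).le), EReal.real_coe_toENNReal]
      exact ENNReal.Tendsto.mul_const h1 (Or.inr ENNReal.ofReal_ne_top)
  exact (le_of_tendsto' hlim hbound).trans_lt ENNReal.ofReal_lt_top

end Ratio

/-! ### Almost everywhere convergence. -/

section Limit

variable {X : Type*} {T : X → X}

theorem toReal_max_mul_coe (y : EReal) {w : ℝ} (hw : 0 < w) (M : ℝ) :
    (max (y * (w : EReal)) ((-(M * w) : ℝ) : EReal)).toReal
      = (max y ((-M : ℝ) : EReal)).toReal * w := by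
  have e : max (y * (w : EReal)) ((-(M * w) : ℝ) : EReal)
      = max y ((-M : ℝ) : EReal) * (w : EReal) := by
    have hmono : Monotone fun z : EReal => z * (w : EReal) := fun _ _ hz =>
      mul_le_mul_of_nonneg_right hz (by exact_mod_cast hw.le)
    rw [hmono.map_max]
    congr 1
    rw [← EReal.coe_mul, neg_mul]
  rw [e, EReal.toReal_mul, EReal.toReal_coe]

/-- This supplies the comparison function: the floor `-M` makes it integrable even where `h = ⊥`,
and `ε` puts it strictly above the lower limit. -/
theorem exists_le_birkhoffSum_truncated {a : ℕ → X → EReal} {g : X → ℝ} (hg0 : ∀ x, 0 < g x)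
    {x : X} (hinv : ∀ k : ℕ, ratioLiminf T a g (T^[k] x) = ratioLiminf T a g x)
    (hlt : ratioLiminf T a g x < ⊤) (M : ℕ) {ε : ℝ} (hε : 0 < ε) :
    (∀ n, birkhoffSum T (fun y => ((max (ratioLiminf T a g y) ((-M : ℝ) : EReal)).toReal + ε)
        * g y) n x
      = ((max (ratioLiminf T a g x) ((-M : ℝ) : EReal)).toReal + ε) * birkhoffSum T g n x) ∧
    ∃ n : ℕ, 1 ≤ n ∧ a n x ≤ (birkhoffSum T
      (fun y => ((max (ratioLiminf T a g y) ((-M : ℝ) : EReal)).toReal + ε) * g y) n x : ℝ) := by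
  have hS := birkhoffSum_mul_of_invariant (g := g) (T := T) (x := x)
    (φ := fun y => (max (ratioLiminf T a g y) ((-M : ℝ) : EReal)).toReal + ε)
    (fun k => by simp only [hinv k])
  refine ⟨hS, ?_⟩
  simp only [hS]
  refine (frequently_le_mul_of_ratioLiminf_lt hg0 ?_).exists
  have hne : max (ratioLiminf T a g x) ((-M : ℝ) : EReal) ≠ ⊤ :=
    (max_lt hlt (EReal.coe_lt_top _)).ne
  refine (le_max_left _ ((-M : ℝ) : EReal)).trans_lt ?_
  refine (EReal.le_coe_toReal hne).trans_lt (EReal.coe_lt_coe_iff.2 ?_)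
  linarith

theorem birkhoffSum_iterate_birkhoffSum {M : Type*} [AddCommMonoid M] (f : X → M) (k n : ℕ)
    (x : X) : birkhoffSum T^[k] (birkhoffSum T f k) n x = birkhoffSum T f (k * n) x := by
  induction n generalizing x with
  | zero => simp
  | succ n ih => rw [birkhoffSum_succ', ih, mul_add_one, add_comm (k * n) k, birkhoffSum_add]

theorem subadditive_le_birkhoffSum_iterate {a : ℕ → X → EReal} {x : X}
    (hsub : ∀ k n m : ℕ, 1 ≤ n → 1 ≤ m →
      a (n + m) (T^[k] x) ≤ a n (T^[k] x) + a m (T^[n] (T^[k] x)))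
    {k : ℕ} (hk : 1 ≤ k) {b : X → ℝ} (hb : ∀ j, a k (T^[j] x) ≤ b (T^[j] x)) {n : ℕ} (hn : 1 ≤ n) :
    a (k * n) x ≤ (birkhoffSum T^[k] b n x : ℝ) := by
  suffices h : ∀ j, a (k * n) (T^[j] x) ≤ (birkhoffSum T^[k] b n (T^[j] x) : ℝ) from h 0
  induction n, hn using Nat.le_induction with
  | base => simpa using hb
  | succ n hn ih =>
    intro j
    rw [mul_add_one, add_comm]
    refine (hsub j k (k * n) hk (Nat.mul_pos hk hn)).trans ?_
    rw [birkhoffSum_succ', EReal.coe_add]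
    refine add_le_add (hb j) ?_
    rw [← Function.iterate_add_apply]
    exact ih _

variable [MeasurableSpace X] {μ : Measure X}

theorem integrable_toReal_max {f : X → EReal} (hf : Measurable f) (hp : PosPartIntegrable μ f)
    {w : X → ℝ} (hw : Measurable w) (hwi : Integrable w μ) (hw0 : ∀ x, 0 < w x) (M : ℕ) :
    Integrable (fun x => (max (f x) ((-(M * w x) : ℝ) : EReal)).toReal) μ ∧
      ∀ᵐ x ∂μ, max (f x) ((-(M * w x) : ℝ) : EReal)
        = ((max (f x) ((-(M * w x) : ℝ) : EReal)).toReal : EReal) := by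
  refine integrable_toReal_of_posPart_of_negPart
    (hf.max (hw.const_mul (M : ℝ)).neg.coe_real_ereal) (ne_of_lt ?_) (ne_of_lt ?_)
  · refine lt_of_le_of_lt (lintegral_mono fun x => ?_) hp
    have h0 : ((-(M * w x) : ℝ) : EReal) ≤ 0 := by
      exact_mod_cast neg_nonpos.2 (mul_nonneg M.cast_nonneg (hw0 x).le)
    rcases le_total (f x) 0 with h | h
    · exact (EReal.toENNReal_of_nonpos (max_le h h0)).trans_le zero_le
    · exact (congrArg EReal.toENNReal (max_eq_left (h0.trans h))).le
  · refine lt_of_le_of_lt (lintegral_mono fun x => ?_) (hwi.const_mul (M : ℝ)).lintegral_lt_top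
    rw [← EReal.real_coe_toENNReal]
    refine EReal.toENNReal_le_toENNReal (EReal.neg_le_of_neg_le ?_)
    exact le_max_right _ _

theorem integrable_truncated_mul {h : X → EReal} (hm : Measurable h) {g : X → ℝ}
    (hg : Measurable g) (hgi : Integrable g μ) (hg0 : ∀ x, 0 < g x)
    (hpos : PosPartIntegrable μ fun x => h x * (g x : EReal)) (M : ℕ) :
    Integrable (fun x => (max (h x) ((-M : ℝ) : EReal)).toReal * g x) μ ∧
      extIntegral μ (fun x => max (h x * (g x : EReal)) ((-(M * g x) : ℝ) : EReal))
        = (∫ x, (max (h x) ((-M : ℝ) : EReal)).toReal * g x ∂μ : ℝ) := by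
  have h1 := integrable_toReal_max (f := fun x => h x * (g x : EReal)) (hm.mul hg.coe_real_ereal) hpos hg hgi hg0 M
  simp only [toReal_max_mul_coe _ (hg0 _)] at h1
  exact ⟨h1.1, (extIntegral_congr_ae h1.2).trans (extIntegral_coe h1.1)⟩

theorem SubadditiveSeq.ae_tendsto_ratioLiminf (hT : MeasurePreserving T μ μ)
    {a : ℕ → X → EReal} (ha_meas : ∀ n : ℕ, 1 ≤ n → Measurable (a n)) (ha : SubadditiveSeq μ T a)
    (ha_one : PosPartIntegrable μ (a 1)) {g : X → ℝ} (hg : Measurable g)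
    (hgi : Integrable g μ) (hg0 : ∀ x, 0 < g x)
    (hinv : ∀ᵐ x ∂μ, ∀ k : ℕ, ratioLiminf T a g (T^[k] x) = ratioLiminf T a g x)
    (hlt : ∀ᵐ x ∂μ, ratioLiminf T a g x < ⊤)
    (hpos : PosPartIntegrable μ fun x => ratioLiminf T a g x * (g x : EReal)) :
    ∀ᵐ x ∂μ, Tendsto (fun n : ℕ => a n x / ((birkhoffSum T g n x : ℝ) : EReal)) atTop
      (𝓝 (ratioLiminf T a g x)) := by
  set h := ratioLiminf T a g with hh
  have hm : Measurable h := measurable_ratioLiminf hT.measurable ha_meas hg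
  -- Countably many parameters keep a single null set. One `ε` comes from the comparison function,
  -- the other from the error `S_n (ε g)`.
  have hev : ∀ᵐ x ∂μ, ∀ M j : ℕ, ∀ᶠ n : ℕ in atTop, a n x
      ≤ (((max (h x) ((-M : ℝ) : EReal)).toReal + 2 * (1 / ((j : ℝ) + 1)))
          * birkhoffSum T g n x : ℝ) := by
    refine ae_all_iff.2 fun M => ae_all_iff.2 fun j => ?_
    have hε : (0 : ℝ) < 1 / ((j : ℝ) + 1) := by positivity
    set ε : ℝ := 1 / ((j : ℝ) + 1)
    have h1 : Integrable (fun x => ((max (h x) ((-M : ℝ) : EReal)).toReal + ε) * g x) μ := by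
      simp only [add_mul]
      exact (integrable_truncated_mul hm hg hgi hg0 hpos M).1.add (hgi.const_mul ε)
    have h2 := ha.ae_eventually_le_birkhoffSum_add hT ha_meas ha_one
      (((hm.max measurable_const).ereal_toReal.add_const ε).mul hg) h1 (by
        filter_upwards [hinv, hlt] with x hx1 hx2
        exact (exists_le_birkhoffSum_truncated hg0 hx1 hx2 M hε).2)
      (hg.const_mul ε) (fun x => mul_pos hε (hg0 x))
    filter_upwards [hinv, hlt, h2] with x hx1 hx2 hx3
    filter_upwards [hx3] with n hn
    refine hn.trans (EReal.coe_le_coe_iff.2 (le_of_eq ?_))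
    have e1 := (exists_le_birkhoffSum_truncated hg0 hx1 hx2 M hε).1 n
    have e2 : birkhoffSum T (fun y => ε * g y) n x = ε * birkhoffSum T g n x := by
      simp [birkhoffSum, Finset.mul_sum]
    rw [e2]
    refine (congrArg (· + ε * birkhoffSum T g n x) e1).trans ?_
    ring
  filter_upwards [hev, hlt] with x hx hx2
  refine tendsto_order.2 ⟨fun c hc => eventually_lt_of_lt_ratioLiminf hc, fun c hc => ?_⟩
  obtain ⟨c₂, hc2, hc2'⟩ := EReal.lt_iff_exists_real_btwn.1 hc
  obtain ⟨c₁, hc1, hc1'⟩ := EReal.lt_iff_exists_real_btwn.1 hc2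
  rw [EReal.coe_lt_coe_iff] at hc1'
  obtain ⟨M, hM⟩ := exists_nat_ge (-c₁)
  obtain ⟨j, hj⟩ := exists_nat_one_div_lt (show 0 < (c₂ - c₁) / 2 by linarith)
  filter_upwards [hx M j, eventually_ge_atTop 1] with n hn hn1
  refine lt_of_le_of_lt ((div_birkhoffSum_le_iff hg0 hn1 x _ c₂).2 (hn.trans ?_)) hc2'
  refine EReal.coe_le_coe_iff.2
    (mul_le_mul_of_nonneg_right ?_ (birkhoffSum_pos hg0 hn1 x).le)
  have h3 : (max (h x) ((-M : ℝ) : EReal)).toReal ≤ c₁ := by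
    have h4 : max (h x) ((-M : ℝ) : EReal) ≤ c₁ :=
      max_le hc1.le (EReal.coe_le_coe_iff.2 (by linarith))
    have h5 : max (h x) ((-M : ℝ) : EReal) ≠ ⊥ :=
      ((EReal.bot_lt_coe _).trans_le (le_max_right _ _)).ne'
    simpa using EReal.toReal_le_toReal h4 h5 (EReal.coe_ne_top _)
  linarith

end Limit

/-! ### Upper and lower bounds for the mean integrals. -/

section Integrals

variable {X : Type*} [MeasurableSpace X] {μ : Measure X} {T : X → X}

theorem SubadditiveSeq.eventually_extIntegral_div_lt (hT : MeasurePreserving T μ μ)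
    {a : ℕ → X → EReal} (ha_meas : ∀ n : ℕ, 1 ≤ n → Measurable (a n)) (ha : SubadditiveSeq μ T a)
    (ha_one : PosPartIntegrable μ (a 1)) {g : X → ℝ} (hg : Measurable g)
    (hgi : Integrable g μ) (hg0 : ∀ x, 0 < g x)
    (hinv : ∀ᵐ x ∂μ, ∀ k : ℕ, ratioLiminf T a g (T^[k] x) = ratioLiminf T a g x)
    (hlt : ∀ᵐ x ∂μ, ratioLiminf T a g x < ⊤)
    (hpos : PosPartIntegrable μ fun x => ratioLiminf T a g x * (g x : EReal)) {c : EReal}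
    (hc : extIntegral μ (fun x => ratioLiminf T a g x * (g x : EReal)) < c) :
    ∀ᶠ n : ℕ in atTop, extIntegral μ (a n) / (n : EReal) < c := by
  set h := ratioLiminf T a g with hh
  have hm : Measurable h := measurable_ratioLiminf hT.measurable ha_meas hg
  obtain ⟨c₁, hc1, hc1'⟩ := EReal.lt_iff_exists_real_btwn.1 hc
  obtain ⟨M, hM⟩ := ((tendsto_extIntegral_max (hm.mul hg.coe_real_ereal) hpos hg
    hg0).eventually_lt_const hc1).exists
  obtain ⟨hi, he⟩ := integrable_truncated_mul hm hg hgi hg0 hpos M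
  have hM' : ∫ x, (max (h x) ((-M : ℝ) : EReal)).toReal * g x ∂μ < c₁ :=
    EReal.coe_lt_coe_iff.1 (he ▸ hM)
  set I := ∫ x, (max (h x) ((-M : ℝ) : EReal)).toReal * g x ∂μ
  have hG : 0 ≤ ∫ x, g x ∂μ := integral_nonneg fun x => (hg0 x).le
  set G := ∫ x, g x ∂μ
  obtain ⟨ε, hε, hεG⟩ : ∃ ε : ℝ, 0 < ε ∧ ε * G ≤ (c₁ - I) / 2 := by
    -- Half of the gap `c₁ - I` pays for `ε G`, the other half for the `o(n)` error; `G + 1` avoids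
    -- division by zero.
    refine ⟨(c₁ - I) / 2 / (G + 1), by have := sub_pos.2 hM'; positivity, ?_⟩
    rw [div_mul_eq_mul_div, div_le_iff₀ (by linarith)]
    nlinarith
  set ψ : X → ℝ := fun x => ((max (h x) ((-M : ℝ) : EReal)).toReal + ε) * g x with hψ
  have hψm : Measurable ψ := ((hm.max measurable_const).ereal_toReal.add_const ε).mul hg
  have hψi : Integrable ψ μ := by
    simp only [hψ, add_mul]
    exact hi.add (hgi.const_mul ε)
  have hψI : ∫ x, ψ x ∂μ = I + ε * G := by
    simp only [hψ, add_mul]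
    rw [integral_add hi (hgi.const_mul ε), integral_const_mul]
  have hev := ha.eventually_lintegral_sub_birkhoffSum_le hT ha_meas ha_one hψm hψi (by
      filter_upwards [hinv, hlt] with x hx1 hx2
      exact (exists_le_birkhoffSum_truncated hg0 hx1 hx2 M hε).2)
    (δ := ENNReal.ofReal ((c₁ - I) / 2)) (by simpa using hM')
  filter_upwards [hev, eventually_ge_atTop 1] with n hn hn1
  obtain ⟨hSi, hSe⟩ := integral_birkhoffSum hT hψi n
  have h1 := extIntegral_le_of_lintegral_sub_le (ha_meas n hn1)
    (measurable_birkhoffSum hT.measurable hψm n) hSi (by finiteness) hn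
  refine lt_of_le_of_lt ?_ hc1'
  have hn0 : (0 : EReal) < n := by exact_mod_cast hn1
  rw [EReal.div_le_iff_le_mul hn0 (EReal.natCast_ne_top n)]
  refine h1.trans ?_
  rw [hSe, hψI, ENNReal.toReal_mul, ENNReal.toReal_natCast,
    ENNReal.toReal_ofReal (by linarith), ← EReal.coe_coe_eq_natCast, ← EReal.coe_mul,
    EReal.coe_le_coe_iff, ← mul_add]
  exact mul_le_mul_of_nonneg_left (by linarith) n.cast_nonneg

/-- Subadditivity along multiples of `k` bounds `a (k * n)` by the `T^[k]`-Birkhoff sum of any real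
`b ≥ a k`, whereas `(h - ε) S_{kn} g < a (k * n)` for large `n`. So `S_k ((h - ε) g) - b` has a
nonpositive sum under `T^[k]`, hence nonpositive integral. -/
theorem SubadditiveSeq.extIntegral_le_div (hT : MeasurePreserving T μ μ)
    {a : ℕ → X → EReal} (ha_meas : ∀ n : ℕ, 1 ≤ n → Measurable (a n)) (ha : SubadditiveSeq μ T a)
    (ha_one : PosPartIntegrable μ (a 1)) {g : X → ℝ} (hg : Measurable g)
    (hgi : Integrable g μ) (hg0 : ∀ x, 0 < g x)
    (hinv : ∀ᵐ x ∂μ, ∀ k : ℕ, ratioLiminf T a g (T^[k] x) = ratioLiminf T a g x)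
    (hlt : ∀ᵐ x ∂μ, ratioLiminf T a g x < ⊤)
    (hpos : PosPartIntegrable μ fun x => ratioLiminf T a g x * (g x : EReal)) {k : ℕ}
    (hk : 1 ≤ k) :
    extIntegral μ (fun x => ratioLiminf T a g x * (g x : EReal))
      ≤ extIntegral μ (a k) / (k : EReal) := by
  set h := ratioLiminf T a g with hh
  have hm : Measurable h := measurable_ratioLiminf hT.measurable ha_meas hg
  by_cases hneg : ∫⁻ x, (-(h x * (g x : EReal))).toENNReal ∂μ = ⊤
  · have : extIntegral μ (fun x => h x * (g x : EReal)) = ⊥ := by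
      unfold extIntegral
      rw [hneg, EReal.coe_ennreal_top, EReal.sub_top]
    rw [this]
    exact bot_le
  obtain ⟨hIi, hIe⟩ := integrable_toReal_of_posPart_of_negPart
    (f := fun x => h x * (g x : EReal)) (hm.mul hg.coe_real_ereal) hpos.ne hneg
  have hJ := (extIntegral_congr_ae hIe).trans (extIntegral_coe hIi)
  simp only [EReal.toReal_mul, EReal.toReal_coe] at hIi hJ
  rw [hJ]
  have hk0 : (0 : EReal) < k := by exact_mod_cast hk
  rw [EReal.le_div_iff_mul_le hk0 (EReal.natCast_ne_top k), ← EReal.coe_coe_eq_natCast,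
    ← EReal.coe_mul]
  have hak := ha.posPartIntegrable hT ha_meas ha_one hk
  -- `a k` may fail to be integrable, so it is floored at `-R g` and `R → ∞` is taken at the end.
  refine ge_of_tendsto' (tendsto_extIntegral_max (ha_meas k hk) hak hg hg0) fun R => ?_
  obtain ⟨hbi, hbe⟩ := integrable_toReal_max (ha_meas k hk) hak hg hgi hg0 R
  rw [(extIntegral_congr_ae hbe).trans (extIntegral_coe hbi), EReal.coe_le_coe_iff]
  have hbm : Measurable fun x => (max (a k x) ((-(R * g x) : ℝ) : EReal)).toReal :=
    ((ha_meas k hk).max (hg.const_mul (R : ℝ)).neg.coe_real_ereal).ereal_toReal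
  have hale : ∀ᵐ x ∂μ,
      a k x ≤ (((max (a k x) ((-(R * g x) : ℝ) : EReal)).toReal : ℝ) : EReal) := by
    filter_upwards [hbe] with x hx
    exact (le_max_left _ _).trans hx.le
  set b : X → ℝ := fun x => (max (a k x) ((-(R * g x) : ℝ) : EReal)).toReal
  refine le_of_forall_pos_le_add fun η hη => ?_
  have hG : 0 ≤ ∫ x, g x ∂μ := integral_nonneg fun x => (hg0 x).le
  set G := ∫ x, g x ∂μ
  obtain ⟨ε, hε, hεG⟩ : ∃ ε : ℝ, 0 < ε ∧ k * (ε * G) ≤ η := by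
    have hk' : (0 : ℝ) < k := by exact_mod_cast hk
    refine ⟨η / (k * (G + 1)), by positivity, ?_⟩
    have : k * (η / (k * (G + 1)) * G) = η * (G / (G + 1)) := by field_simp
    rw [this]
    exact mul_le_of_le_one_right hη.le ((div_le_one (by linarith)).2 (by linarith))
  set φ : X → ℝ := fun x => (h x).toReal - ε with hφ
  have hφm : Measurable fun x => φ x * g x := (hm.ereal_toReal.sub_const ε).mul hg
  have hφi : Integrable (fun x => φ x * g x) μ := by
    simp only [hφ, sub_mul]
    exact hIi.sub (hgi.const_mul ε)
  have hφI : ∫ x, φ x * g x ∂μ = ∫ x, (h x).toReal * g x ∂μ - ε * G := by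
    simp only [hφ, sub_mul]
    rw [integral_sub hIi (hgi.const_mul ε), integral_const_mul]
  obtain ⟨hSi, hSe⟩ := integral_birkhoffSum hT hφi k
  have hmain := integral_nonpos_of_exists_birkhoffSum_nonpos (hT.iterate k)
    ((measurable_birkhoffSum hT.measurable hφm k).sub hbm) (hSi.sub hbi) (by
      filter_upwards [hinv, hlt, hIe, ha.ae_orbit hT.quasiMeasurePreserving,
        ae_forall_iterate hT.quasiMeasurePreserving hale] with x hx1 hx2 hx3 hx4 hx5
      have hbot : h x ≠ ⊥ := by
        intro hb
        rw [hb, EReal.bot_mul_coe_of_pos (hg0 x)] at hx3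
        exact EReal.coe_ne_bot _ hx3.symm
      have hφx : ((φ x : ℝ) : EReal) < h x := by
        rw [← EReal.coe_toReal hx2.ne hbot]
        exact EReal.coe_lt_coe_iff.2 (by simp only [hφ]; linarith)
      obtain ⟨N, hN⟩ := eventually_atTop.1 (eventually_mul_lt_of_lt_ratioLiminf hg0 hφx)
      refine ⟨N + 1, by omega, ?_⟩
      have h1 := hN (k * (N + 1)) (by nlinarith)
      have h2 := h1.trans_le (subadditive_le_birkhoffSum_iterate (b := b) (n := N + 1) hx4 hk
        hx5 (by omega))
      rw [EReal.coe_lt_coe_iff, ← birkhoffSum_mul_of_invariant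
        (fun j => by simp only [hφ, hx1 j]), ← birkhoffSum_iterate_birkhoffSum] at h2
      have e : birkhoffSum T^[k] (birkhoffSum T (fun y => φ y * g y) k - b) (N + 1) x
          = birkhoffSum T^[k] (birkhoffSum T (fun y => φ y * g y) k) (N + 1) x
            - birkhoffSum T^[k] b (N + 1) x := by
        simp [birkhoffSum]
      exact e.trans_le (sub_nonpos.2 h2.le))
  have e : ∫ x, (birkhoffSum T (fun y => φ y * g y) k - b) x ∂μ
      = k * (∫ x, (h x).toReal * g x ∂μ - ε * G) - ∫ x, b x ∂μ := by
    rw [← hφI, ← hSe, ← integral_sub hSi hbi]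
    rfl
  have h3 := e.symm.trans_le hmain
  rw [mul_sub] at h3
  linarith

end Integrals

/-! ### Regularising `g` and assembling the theorem. -/

theorem exists_measurable_pos_ae_eq {X : Type*} [MeasurableSpace X] {μ : Measure X} {g : X → ℝ}
    (hg : AEMeasurable g μ) (hg_pos : ∀ᵐ x ∂μ, 0 < g x) :
    ∃ g' : X → ℝ, Measurable g' ∧ (∀ x, 0 < g' x) ∧ ∀ᵐ x ∂μ, g x = g' x := by
  refine ⟨fun x => if 0 < hg.mk g x then hg.mk g x else 1,
    Measurable.ite (measurableSet_lt measurable_const hg.measurable_mk) hg.measurable_mk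
      measurable_const, fun x => ?_, ?_⟩
  · dsimp only
    split_ifs with h
    · exact h
    · exact one_pos
  · filter_upwards [hg.ae_eq_mk, hg_pos] with x h1 h2
    rw [if_pos (h1 ▸ h2), h1]

theorem theorem2 {X : Type*} [MeasurableSpace X] (μ : Measure X) [SigmaFinite μ]
    (T : X → X) (hT : MeasurePreserving T μ μ) (hcons : Conservative T μ)
    (a : ℕ → X → EReal) (ha_meas : ∀ n : ℕ, 1 ≤ n → Measurable (a n))
    (ha_sub : SubadditiveSeq μ T a) (ha_one : PosPartIntegrable μ (a 1))
    (g : X → ℝ) (hg_int : Integrable g μ) (hg_pos : ∀ᵐ x ∂μ, 0 < g x) :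
    ∃ h : X → EReal, Measurable h ∧
      (∀ᵐ x ∂μ, Tendsto (fun n : ℕ => a n x / ((birkhoffSum T g n x : ℝ) : EReal))
        atTop (𝓝 (h x)) ∧ h x < ⊤) ∧
      (∀ n : ℕ, 1 ≤ n → PosPartIntegrable μ (a n)) ∧
      PosPartIntegrable μ (fun x => h x * (g x : EReal)) ∧
      ∀ A : Set X, MeasurableSet A → T ⁻¹' A = A →
        (⨅ (n : ℕ) (_ : 1 ≤ n), extIntegral (μ.restrict A) (a n) / (n : EReal)) =
          extIntegral (μ.restrict A) (fun x => h x * (g x : EReal)) ∧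
        Tendsto (fun n : ℕ => extIntegral (μ.restrict A) (a n) / (n : EReal)) atTop
          (𝓝 (extIntegral (μ.restrict A) (fun x => h x * (g x : EReal)))) ∧
        extIntegral (μ.restrict A) (fun x => h x * (g x : EReal)) < ⊤ := by
  obtain ⟨g', hg', hg0, hgg⟩ := exists_measurable_pos_ae_eq hg_int.aemeasurable hg_pos
  have hgi : Integrable g' μ := hg_int.congr hgg
  have hinv := ha_sub.ae_ratioLiminf_iterate_eq hT hcons ha_meas ha_one hg' hg0
  have hpos := ha_sub.posPartIntegrable_ratioLiminf_mul hT hcons ha_meas ha_one hg' hgi hg0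
  have hm : Measurable (ratioLiminf T a g') := measurable_ratioLiminf hT.measurable ha_meas hg'
  have hlt : ∀ᵐ x ∂μ, ratioLiminf T a g' x < ⊤ := by
    filter_upwards [ae_lt_top (hm.mul hg'.coe_real_ereal).ereal_toENNReal hpos.ne] with x hx
    refine lt_top_iff_ne_top.2 fun h => ?_
    simp [h, EReal.top_mul_coe_of_pos (hg0 x)] at hx
  have hgmul : ∀ᵐ x ∂μ, ratioLiminf T a g' x * (g x : EReal)
      = ratioLiminf T a g' x * (g' x : EReal) := by
    filter_upwards [hgg] with x hx
    rw [hx]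
  refine ⟨ratioLiminf T a g', hm, ?_, fun n hn => ha_sub.posPartIntegrable hT ha_meas ha_one hn,
    hpos.mono_ae (hgmul.mono fun _ => le_of_eq), fun A hA hTA => ?_⟩
  · filter_upwards [ha_sub.ae_tendsto_ratioLiminf hT ha_meas ha_one hg' hgi hg0 hinv hlt hpos, hlt,
      ae_forall_iterate hT.quasiMeasurePreserving hgg] with x h1 h2 h3
    refine ⟨h1.congr fun n => ?_, h2⟩
    rw [show birkhoffSum T g n x = birkhoffSum T g' n x from
      Finset.sum_congr rfl fun k _ => h3 k]
  -- The integral bounds take invariance, finiteness and integrability of `h` as hypotheses, so they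
  -- apply to `μ.restrict A` with the same global `h`.
  have hTr : MeasurePreserving T (μ.restrict A) (μ.restrict A) := by
    have := hT.restrict_preimage hA
    rwa [hTA] at this
  have hsub : SubadditiveSeq (μ.restrict A) T a := fun n m hn hm =>
    ae_restrict_of_ae (ha_sub n m hn hm)
  rw [extIntegral_congr_ae (ae_restrict_of_ae hgmul)]
  have hup : ∀ c, extIntegral (μ.restrict A) (fun x => ratioLiminf T a g' x * (g' x : EReal)) < c →
      ∀ᶠ n : ℕ in atTop, extIntegral (μ.restrict A) (a n) / (n : EReal) < c := fun c hc =>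
    hsub.eventually_extIntegral_div_lt hTr ha_meas (ha_one.restrict A) hg' hgi.restrict hg0
      (ae_restrict_of_ae hinv) (ae_restrict_of_ae hlt) (hpos.restrict A) hc
  have hlow : ∀ n : ℕ, 1 ≤ n →
      extIntegral (μ.restrict A) (fun x => ratioLiminf T a g' x * (g' x : EReal))
        ≤ extIntegral (μ.restrict A) (a n) / (n : EReal) := fun n hn =>
    hsub.extIntegral_le_div hTr ha_meas (ha_one.restrict A) hg' hgi.restrict hg0
      (ae_restrict_of_ae hinv) (ae_restrict_of_ae hlt) (hpos.restrict A) hn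
  refine ⟨le_antisymm (le_of_forall_gt fun c hc => ?_) (le_iInf₂ hlow),
    tendsto_order.2 ⟨fun c hc => ?_, hup⟩, (hpos.restrict A).extIntegral_lt_top⟩
  · obtain ⟨n, hn, hn1⟩ := ((hup c hc).and (eventually_ge_atTop 1)).exists
    exact (iInf₂_le n hn1).trans_lt hn
  · filter_upwards [eventually_ge_atTop 1] with n hn using hc.trans_le (hlow n hn)
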